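/- **Abstract Leray theorem for open coverings.** Let $X$ be a topological space, $R$ a ring, and $\mathcal{U}$ a covering of $X$ by subsets whose interiors cover $X$. Let $N$ be the nerve of $\mathcal{U}$: its vertices correspond to the elements of $\mathcal{U}$, and its simplices are the finite non-empty sets of vertices for which the corresponding elements of $\mathcal{U}$ have non-empty intersection. For a simplex $\sigma$ let $|\sigma|$ be the intersection of the elements of $\mathcal{U}$ corresponding to its vertices, and let $\mathcal{U}^{\cap}$ be the collection of all the sets $|\sigma|$. Fix a linear order on the set of vertices, let $N_p$ be the set of $p$-simplices of $N$, and for a simplex $\sigma$ with vertices $v_0<v_1<\dots$ put $\partial_i\sigma=\sigma\smallsetminus\{v_i\}$. Let $C^\bullet(N)$ be the complex of simplicial cochains of $N$ with coefficients in $R$, where $\delta c(\sigma)=\sum_i(-1)^i c(\partial_i\sigma)$, and let $H^*(N)$ be its cohomology. Let $A^\bullet$ be a contravariant functor from the category of subspaces of $X$ and inclusions to the category of augmented cochain complexes of $R$-modules $$0\to R\xrightarrow{d_{-1}}A^0(Z)\xrightarrow{d_0}A^1(Z)\xrightarrow{d_1}\cdots ,$$ the morphisms being the morphisms of complexes which are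 the identity on the term $R$. The morphism corresponding to an inclusion $Y\subset Z$ is written $c\mapsto c|_Y$. Let $H_A^*(X)$ be the cohomology of $A^\bullet(X)$ with the term $R$ omitted. An example is the functor $C^\bullet$ of singular cochains with coefficients in $R$, augmented by the constant $0$-cochains; its cohomology $H^*(X)$ is the singular cohomology of $X$. Put $C^p(N,A^q)=\prod_{\sigma\in N_p}A^q(|\sigma|)$ and $(\delta c)_\sigma=\sum_i(-1)^i c_{\partial_i\sigma}\big|_{|\sigma|}$. Let $T^\bullet(N,A)$ be the total complex of this double complex, $$T^n(N,A)=\bigoplus_{p+q=n}C^p(N,A^q),\qquad D=\delta+(-1)^p d\ \text{ on } C^p(N,A^q).$$ The maps $d_{-1}$ define a morphism $\lambda_A:C^\bullet(N)\to T^\bullet(N,A)$, and the restrictions $a\mapsto(a|_{|\sigma|})_{\sigma\in N_0}$ define a morphism $\tau_A:A^\bullet(X)\to T^\bullet(N,A)$, where the augmentation term of $A^\bullet(X)$ is omitted. Let $\varphi^\bullet:A^\bullet\to C^\bullet$ be a natural transformation (of functors to augmented complexes), and suppose that $\mathcal{U}$ is $A^\bullet$-acyclic, that is, the augmented complex $A^\bullet(Z)$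 is exact for every $Z\in\mathcal{U}^{\cap}$. Then the homomorphism $\tau_{C*}$ induced by $\tau_C$ in cohomology is an isomorphism, so that the canonical homomorphism $$l_{\mathcal{U}}=\tau_{C*}^{-1}\circ\lambda_{C*}:H^*(N)\to H^*(X)$$ is defined, and in every degree the homomorphism $H_A^*(X)\to H^*(X)$ induced by $\varphi^\bullet$ factors through $l_{\mathcal{U}}$: for every $n\ge 0$ there is a homomorphism of $R$-modules $\psi:H_A^n(X)\to H^n(N)$ such that $l_{\mathcal{U}}\circ\psi$ is the homomorphism $H_A^n(X)\to H^n(X)$. -/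

import Mathlib

set_option linter.unusedSectionVars false

open CategoryTheory Opposite

universe u v w

noncomputable section

namespace Leray

/-! ### Simplicial cochains of a simplicial complex with linearly ordered vertices -/

section Simplices

variable {V : Type u} [LinearOrder V]

/-- `Simp K p` is the set of `p`-dimensional simplices of `K`. -/
abbrev Simp (K : PreAbstractSimplicialComplex V) (p : ℕ) : Type u :=
  {σ : Finset V // σ ∈ K.faces ∧ σ.card = p + 1}

/-- The face `σ ∖ {v}` opposite to a vertex `v` of a simplex `σ` of positive dimension. -/
abbrev Simp.face {K : PreAbstractSimplicialComplex V} {p : ℕ} (σ : Simp K (p + 1)) (v : σ.1) :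
    Simp K p :=
  ⟨σ.1.erase v, by
    have hc : (σ.1.erase v).card = p + 1 := by
      rw [Finset.card_erase_of_mem v.2, σ.2.2]; rfl
    refine ⟨(K.isRelLowerSet_faces σ.2.1).2 (Finset.erase_subset _ _) ?_, hc⟩
    rw [← Finset.card_pos]; omega⟩

/-- The position of `v` in the increasing list `v₀ < v₁ < …` of the elements of `σ`,
that is, the index `i` such that `v = vᵢ`. -/
def pos (σ : Finset V) (v : V) : ℕ := (σ.filter (· < v)).card

lemma sign_swap {σ : Finset V} {x y : V} (hx : x ∈ σ) (hy : y ∈ σ) (h : x ≠ y) :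
    (-1 : ℤ) ^ pos σ x * (-1) ^ pos (σ.erase x) y =
      - ((-1 : ℤ) ^ pos σ y * (-1) ^ pos (σ.erase y) x) := by
  have key : ∀ a b : V, a ∈ σ → b ∈ σ → a < b →
      pos σ b = pos (σ.erase a) b + 1 ∧ pos (σ.erase b) a = pos σ a := by
    intro a b ha hb hab
    constructor
    · unfold pos
      have hmem : a ∈ σ.filter (· < b) := Finset.mem_filter.2 ⟨ha, hab⟩
      rw [Finset.filter_erase, Finset.card_erase_of_mem hmem]
      have := Finset.card_pos.2 ⟨a, hmem⟩
      omega
    · unfold pos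
      congr 1
      ext c
      simp only [Finset.mem_filter, Finset.mem_erase]
      constructor
      · rintro ⟨⟨_, h1⟩, h2⟩; exact ⟨h1, h2⟩
      · rintro ⟨h1, h2⟩; exact ⟨⟨(h2.trans hab).ne, h1⟩, h2⟩
  rcases lt_or_gt_of_ne h with h | h
  · obtain ⟨h1, h2⟩ := key x y hx hy h
    rw [h1, h2]; ring
  · obtain ⟨h1, h2⟩ := key y x hy hx h
    rw [h1, h2]; ring

lemma sum_swap_eq_zero {M : Type*} [AddCommGroup M] (σ : Finset V)
    (f : ∀ x : σ, {y // y ∈ σ.erase x.1} → M)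
    (hf : ∀ (x y : V) (hx : x ∈ σ) (hy : y ∈ σ) (h : x ≠ y),
      f ⟨x, hx⟩ ⟨y, Finset.mem_erase.2 ⟨h.symm, hy⟩⟩ +
        f ⟨y, hy⟩ ⟨x, Finset.mem_erase.2 ⟨h, hx⟩⟩ = 0) :
    ∑ x : σ, ∑ y : {y // y ∈ σ.erase x.1}, f x y = 0 := by
  rw [← Fintype.sum_sigma' (fun x y => f x y)]
  refine Finset.sum_involution
    (fun a _ => ⟨⟨a.2.1, (Finset.mem_erase.1 a.2.2).2⟩,
      ⟨a.1.1, Finset.mem_erase.2 ⟨(Finset.mem_erase.1 a.2.2).1.symm, a.1.2⟩⟩⟩) ?_ ?_ ?_ ?_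
  · rintro ⟨⟨x, hx⟩, ⟨y, hy⟩⟩ _
    exact hf x y hx (Finset.mem_erase.1 hy).2 (Finset.mem_erase.1 hy).1.symm
  · rintro ⟨⟨x, hx⟩, ⟨y, hy⟩⟩ _ _ h
    have h1 := congrArg (fun a => a.1.1) h
    exact (Finset.mem_erase.1 hy).1 h1
  · intro a _; exact Finset.mem_univ _
  · rintro ⟨⟨x, hx⟩, ⟨y, hy⟩⟩ _; rfl

/-- The simplicial coboundary operator `(δ c)(σ) = ∑ᵢ (-1)ⁱ c(∂ᵢ σ)`. -/
def simplicialCoboundary (K : PreAbstractSimplicialComplex V) (R : Type v) [Ring R] (p : ℕ) :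
    (Simp K p → R) →ₗ[R] (Simp K (p + 1) → R) :=
  LinearMap.pi fun σ => ∑ x : σ.1, ((-1 : ℤ) ^ pos σ.1 x) • LinearMap.proj (σ.face x)

lemma simplicialCoboundary_apply (K : PreAbstractSimplicialComplex V) (R : Type v) [Ring R]
    (p : ℕ) (c : Simp K p → R) (σ : Simp K (p + 1)) :
    simplicialCoboundary K R p c σ = ∑ x : σ.1, ((-1 : ℤ) ^ pos σ.1 x) • c (σ.face x) := by
  simp [simplicialCoboundary]

/-- The complex `C^•(K)` of simplicial cochains of `K` with coefficients in `R`. -/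
def simplicialCochains (K : PreAbstractSimplicialComplex V) (R : Type v) [Ring R] :
    CochainComplex (ModuleCat.{max u v} R) ℕ :=
  CochainComplex.of (fun p => ModuleCat.of R (Simp K p → R))
    (fun p => ModuleCat.ofHom (simplicialCoboundary K R p)) (by
      intro p
      refine ModuleCat.hom_ext (LinearMap.ext fun c => funext fun σ => ?_)
      change simplicialCoboundary K R (p + 1) (simplicialCoboundary K R p c) σ = 0
      simp only [simplicialCoboundary_apply, Finset.smul_sum, smul_smul]
      refine sum_swap_eq_zero σ.1
        (fun x y => ((-1 : ℤ) ^ pos σ.1 x * (-1) ^ pos (σ.1.erase x) y) •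
          c ((σ.face x).face y)) ?_
      intro x y hx hy h
      have hc : (σ.face ⟨x, hx⟩).face ⟨y, Finset.mem_erase.2 ⟨h.symm, hy⟩⟩ =
          (σ.face ⟨y, hy⟩).face ⟨x, Finset.mem_erase.2 ⟨h, hx⟩⟩ :=
        Subtype.ext (Finset.erase_right_comm)
      dsimp only
      rw [hc, sign_swap hx hy h, neg_smul, neg_add_cancel])

end Simplices

/-! ### Double complexes and their total complexes -/

/-- A (first quadrant, commutative) double complex of `R`-modules. -/
structure DoubleComplex (R : Type v) [Ring R] where
  X : ℕ → ℕ → ModuleCat.{w} R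
  d : ∀ p q, X p q →ₗ[R] X p (q + 1)
  δ : ∀ p q, X p q →ₗ[R] X (p + 1) q
  d_d : ∀ p q c, d p (q + 1) (d p q c) = 0
  δ_δ : ∀ p q c, δ (p + 1) q (δ p q c) = 0
  d_δ : ∀ p q c, d (p + 1) q (δ p q c) = δ p (q + 1) (d p q c)

namespace DoubleComplex

variable {R : Type v} [Ring R] (K : DoubleComplex.{v, w} R)

/-- `T^n = ⨁_{p + q = n} K^{p,q}`, the (finite) sum being realized as a product. -/
abbrev T (n : ℕ) : Type w := ∀ x : {x : ℕ × ℕ // x.1 + x.2 = n}, K.X x.1.1 x.1.2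

/-- The component in `K^{p,q}` of the part `(-1)^p d` of the total differential. -/
def horizontal (n : ℕ) : ∀ x : {x : ℕ × ℕ // x.1 + x.2 = n + 1}, K.T n →ₗ[R] K.X x.1.1 x.1.2
  | ⟨(_, 0), _⟩ => 0
  | ⟨(p, q + 1), h⟩ => ((-1 : ℤ) ^ p) •
      (K.d p q ∘ₗ LinearMap.proj
        (⟨(p, q), Nat.succ.inj h⟩ : {x : ℕ × ℕ // x.1 + x.2 = n}))

/-- The component in `K^{p,q}` of the part `δ` of the total differential. -/
def vertical (n : ℕ) : ∀ x : {x : ℕ × ℕ // x.1 + x.2 = n + 1}, K.T n →ₗ[R] K.X x.1.1 x.1.2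
  | ⟨(0, _), _⟩ => 0
  | ⟨(p + 1, q), h⟩ =>
      K.δ p q ∘ₗ LinearMap.proj
        (⟨(p, q), by dsimp only at h ⊢; omega⟩ : {x : ℕ × ℕ // x.1 + x.2 = n})

/-- The differential `D` of the total complex: `D = δ + (-1)^p d` on `K^{p,q}`. -/
def D (n : ℕ) : K.T n →ₗ[R] K.T (n + 1) :=
  LinearMap.pi fun x => K.vertical n x + K.horizontal n x

lemma D_D (n : ℕ) (c : K.T n) : K.D (n + 1) (K.D n c) = 0 := by
  funext x
  obtain ⟨⟨p, q⟩, h⟩ := x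
  rcases p with _ | _ | p <;> rcases q with _ | _ | q <;>
    simp [D, vertical, horizontal, K.d_d, K.δ_δ, K.d_δ, pow_succ] at h ⊢

/-- The inclusion `K^{p,q} → T^n` for `p + q = n`. -/
def incl (p q : ℕ) {n : ℕ} (h : p + q = n) : K.X p q →ₗ[R] K.T n :=
  LinearMap.single R (fun x : {x : ℕ × ℕ // x.1 + x.2 = n} => K.X x.1.1 x.1.2) ⟨(p, q), h⟩

lemma D_incl (p q : ℕ) {n : ℕ} (h : p + q = n) (c : K.X p q) :
    K.D n (K.incl p q h c) =
      K.incl (p + 1) q (by omega) (K.δ p q c) +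
        ((-1 : ℤ) ^ p) • K.incl p (q + 1) (by omega) (K.d p q c) := by
  have hs : ∀ (a b m : ℕ) (hab : a + b = m) (k : K.X a b) (a' b' : ℕ) (h' : a' + b' = m),
      ¬ (a' = a ∧ b' = b) → K.incl a b hab k ⟨(a', b'), h'⟩ = 0 := by
    intro a b m hab k a' b' h' hne
    exact Pi.single_eq_of_ne (fun e => hne (by simpa using e)) _
  have hs' : ∀ (a b m : ℕ) (hab : a + b = m) (k : K.X a b),
      K.incl a b hab k ⟨(a, b), hab⟩ = k := fun a b m hab k => Pi.single_eq_same _ _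
  funext ⟨⟨a, b⟩, hab⟩
  change K.vertical n ⟨(a, b), hab⟩ (K.incl p q h c) +
    K.horizontal n ⟨(a, b), hab⟩ (K.incl p q h c) =
      K.incl (p + 1) q (by omega) (K.δ p q c) ⟨(a, b), hab⟩ +
        ((-1 : ℤ) ^ p) • K.incl p (q + 1) (by omega) (K.d p q c) ⟨(a, b), hab⟩
  congr 1
  · rcases a with _ | a
    · rw [hs _ _ _ _ _ _ _ _ (by omega)]; rfl
    · change K.δ a b (K.incl p q h c ⟨(a, b), _⟩) = _
      by_cases e : a = p ∧ b = q
      · obtain ⟨rfl, rfl⟩ := e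
        rw [hs', hs']
      · rw [hs _ _ _ _ _ _ _ _ e, hs _ _ _ _ _ _ _ _ (by omega), map_zero]
  · rcases b with _ | b
    · rw [hs _ _ _ _ _ _ _ _ (by omega), smul_zero]; rfl
    · change ((-1 : ℤ) ^ a) • K.d a b (K.incl p q h c ⟨(a, b), _⟩) = _
      by_cases e : a = p ∧ b = q
      · obtain ⟨rfl, rfl⟩ := e
        rw [hs', hs']
      · rw [hs _ _ _ _ _ _ _ _ e, hs _ _ _ _ _ _ _ _ (by omega), map_zero, smul_zero,
          smul_zero]

/-- The total complex of a double complex. -/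
def total : CochainComplex (ModuleCat.{w} R) ℕ :=
  CochainComplex.of (fun n => ModuleCat.of R (K.T n)) (fun n => ModuleCat.ofHom (K.D n))
    (fun n => ModuleCat.hom_ext (LinearMap.ext fun c => K.D_D n c))

end DoubleComplex

/-! ### Functors of generalized cochains -/

/-- A contravariant functor `A^•` from the category of subspaces of `X` and inclusions to the
category of augmented cochain complexes `0 → R → A⁰(Z) → A¹(Z) → …` of `R`-modules, where the
morphisms of augmented complexes are the identity on the augmentation term `R`. The
complex `functor.obj (op Z)` is `A^•(Z)` with the augmentation term `R` omitted. -/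
structure CochainFunctor (X : Type u) (R : Type v) [Ring R] where
  functor : (Set X)ᵒᵖ ⥤ CochainComplex (ModuleCat.{w} R) ℕ
  aug : ∀ Z : Set X, R →ₗ[R] (functor.obj (op Z)).X 0
  d_aug : ∀ (Z : Set X) (r : R), ((functor.obj (op Z)).d 0 1).hom (aug Z r) = 0
  res_aug : ∀ {Y Z : Set X} (h : Y ⊆ Z) (r : R),
    ((functor.map (homOfLE h).op).f 0).hom (aug Z r) = aug Y r

namespace CochainFunctor

variable {X : Type u} {R : Type v} [Ring R]

/-- A natural transformation of functors with values in augmented cochain complexes. -/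
structure Hom (A B : CochainFunctor.{u, v, w} X R) where
  natTrans : A.functor ⟶ B.functor
  map_aug : ∀ (Z : Set X) (r : R), ((natTrans.app (op Z)).f 0).hom (A.aug Z r) = B.aug Z r

variable (A : CochainFunctor.{u, v, w} X R)

/-- The augmented complex `0 → R → A⁰(Z) → A¹(Z) → A²(Z) → …` is exact. -/
structure IsExact (Z : Set X) : Prop where
  aug_injective : Function.Injective (A.aug Z)
  exact_zero : Function.Exact (A.aug Z) ((A.functor.obj (op Z)).d 0 1).hom
  exact_succ : ∀ q : ℕ, Function.Exact ((A.functor.obj (op Z)).d q (q + 1)).hom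
    ((A.functor.obj (op Z)).d (q + 1) (q + 2)).hom

/-- The `R`-module `A^q(Z)`. -/
abbrev cochains (q : ℕ) (Z : Set X) : ModuleCat.{w} R := (A.functor.obj (op Z)).X q

/-- The restriction homomorphism `A^q(Z) → A^q(Y)` for `Y ⊆ Z`. -/
def res (q : ℕ) {Y Z : Set X} (h : Y ⊆ Z) : A.cochains q Z →ₗ[R] A.cochains q Y :=
  ((A.functor.map (homOfLE h).op).f q).hom

/-- The differential `A^q(Z) → A^{q+1}(Z)`. -/
def diff (q : ℕ) (Z : Set X) : A.cochains q Z →ₗ[R] A.cochains (q + 1) Z :=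
  ((A.functor.obj (op Z)).d q (q + 1)).hom

lemma diff_diff (q : ℕ) (Z : Set X) (c : A.cochains q Z) :
    A.diff (q + 1) Z (A.diff q Z c) = 0 := by
  have := (A.functor.obj (op Z)).d_comp_d q (q + 1) (q + 2)
  exact congrArg (fun f => f.hom c) this

lemma diff_res (q : ℕ) {Y Z : Set X} (h : Y ⊆ Z) (c : A.cochains q Z) :
    A.diff q Y (A.res q h c) = A.res (q + 1) h (A.diff q Z c) := by
  have := (A.functor.map (homOfLE h).op).comm q (q + 1)
  exact congrArg (fun f => f.hom c) this

lemma res_res (q : ℕ) {W Y Z : Set X} (h : W ⊆ Y) (h' : Y ⊆ Z) (c : A.cochains q Z) :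
    A.res q h (A.res q h' c) = A.res q (h.trans h') c := by
  have := A.functor.map_comp (homOfLE h').op (homOfLE h).op
  exact (congrArg (fun f => (f.f q).hom c) this).symm

/-- The `A^•`-cohomology `H_A^n(Z)`, the cohomology of `A^•(Z)` with the term `R` omitted. -/
abbrev cohomology (n : ℕ) (Z : Set X) : ModuleCat.{w} R := (A.functor.obj (op Z)).homology n

end CochainFunctor

/-! ### The double complex of a covering -/

section Covering

variable {X : Type u} {V : Type u} [LinearOrder V] (U : V → Set X)

/-- The nerve of a family of subsets: its simplices are the finite non-empty sets of indices
such that the corresponding sets have a common point. -/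
def nerve : PreAbstractSimplicialComplex V where
  faces := {σ | σ.Nonempty ∧ (⋂ x ∈ σ, U x).Nonempty}
  isRelLowerSet_faces := fun _ h =>
    ⟨h.1, fun _ hτ hne => ⟨hne, h.2.mono (Set.biInter_subset_biInter_left hτ)⟩⟩

/-- The intersection `|σ|` of the sets corresponding to the vertices of `σ`. -/
def inter (σ : Finset V) : Set X := ⋂ x ∈ σ, U x

lemma inter_anti {σ τ : Finset V} (h : τ ⊆ σ) : inter U σ ⊆ inter U τ :=
  Set.biInter_subset_biInter_left h

lemma inter_face {p : ℕ} (σ : Simp (nerve U) (p + 1)) (x : σ.1) :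
    inter U σ.1 ⊆ inter U (σ.face x).1 :=
  inter_anti U (Finset.erase_subset x.1 σ.1)

variable {R : Type v} [Ring R]

/-- The family `U` is `A^•`-acyclic: the augmented complex `A^•(|σ|)` is exact for every
simplex `σ` of the nerve. -/
def IsAcyclic (A : CochainFunctor.{u, v, w} X R) : Prop :=
  ∀ σ ∈ (nerve U).faces, A.IsExact (inter U σ)

variable (A : CochainFunctor.{u, v, max u v} X R)

/-- `C^p(N, A^q)`, the product of the modules `A^q(|σ|)` over the `p`-simplices `σ` of `N`. -/
abbrev nerveCochains (p q : ℕ) : Type (max u v) :=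
  ∀ σ : Simp (nerve U) p, A.cochains q (inter U σ.1)

/-- The differential `d : C^p(N, A^q) → C^p(N, A^{q+1})`. -/
def nerveD (p q : ℕ) : nerveCochains U A p q →ₗ[R] nerveCochains U A p (q + 1) :=
  LinearMap.pi fun σ => A.diff q (inter U σ.1) ∘ₗ LinearMap.proj σ

/-- The coboundary `(δ c)_σ = ∑ᵢ (-1)ⁱ c_{∂ᵢ σ} | |σ|`. -/
def nerveDelta (p q : ℕ) : nerveCochains U A p q →ₗ[R] nerveCochains U A (p + 1) q :=
  LinearMap.pi fun σ => ∑ x : σ.1, ((-1 : ℤ) ^ pos σ.1 x) •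
    (A.res q (inter_face U σ x) ∘ₗ LinearMap.proj (σ.face x))

lemma nerveDelta_apply (p q : ℕ) (c : nerveCochains U A p q) (σ : Simp (nerve U) (p + 1)) :
    nerveDelta U A p q c σ = ∑ x : σ.1, ((-1 : ℤ) ^ pos σ.1 x) •
      A.res q (inter_face U σ x) (c (σ.face x)) := by
  simp only [nerveDelta, LinearMap.pi_apply, LinearMap.sum_apply, LinearMap.smul_apply]
  rfl

lemma res_congr {p q : ℕ} (c : nerveCochains U A p q) {σ τ : Simp (nerve U) p} (h : σ = τ)
    {Z : Set X} (hσ : Z ⊆ inter U σ.1) (hτ : Z ⊆ inter U τ.1) :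
    A.res q hσ (c σ) = A.res q hτ (c τ) := by
  subst h; rfl

lemma nerveDelta_nerveDelta (p q : ℕ) (c : nerveCochains U A p q) :
    nerveDelta U A (p + 1) q (nerveDelta U A p q c) = 0 := by
  funext σ
  rw [nerveDelta_apply]
  simp only [nerveDelta_apply, map_sum, map_zsmul, Finset.smul_sum, smul_smul]
  refine sum_swap_eq_zero σ.1
    (fun x y => ((-1 : ℤ) ^ pos σ.1 x * (-1) ^ pos (σ.1.erase x) y) •
      A.res q (inter_face U σ x)
        (A.res q (inter_face U (σ.face x) y)
          (c ((σ.face x).face y)))) ?_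
  intro x y hx hy h
  have hc : (σ.face ⟨x, hx⟩).face ⟨y, Finset.mem_erase.2 ⟨h.symm, hy⟩⟩ =
      (σ.face ⟨y, hy⟩).face ⟨x, Finset.mem_erase.2 ⟨h, hx⟩⟩ :=
    Subtype.ext (Finset.erase_right_comm)
  dsimp only
  rw [A.res_res, A.res_res, sign_swap hx hy h, neg_smul, neg_add_eq_zero]
  congr 1
  exact res_congr U A c hc _ _

/-- The double complex `C^•(N, A^•)` of a covering. -/
def nerveDoubleComplex : DoubleComplex.{v, max u v} R where
  X p q := ModuleCat.of R (nerveCochains U A p q)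
  d p q := nerveD U A p q
  δ p q := nerveDelta U A p q
  d_d p q c := by
    funext σ
    exact A.diff_diff q _ (c σ)
  δ_δ := nerveDelta_nerveDelta U A
  d_δ p q c := by
    funext σ
    change A.diff q _ (nerveDelta U A p q c σ) = nerveDelta U A p (q + 1) (nerveD U A p q c) σ
    rw [nerveDelta_apply, nerveDelta_apply]
    simp only [map_sum, map_zsmul, A.diff_res]
    rfl

/-- The total complex `T^•(N, A)`. -/
abbrev nerveTotal : CochainComplex (ModuleCat.{max u v} R) ℕ := (nerveDoubleComplex U A).total

/-- `λ_A` in degree `n`: a simplicial cochain `c` goes to the element of `C^n(N, A⁰)` with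
components `d₋₁(c(σ))`. -/
def lambdaMap (n : ℕ) : (Simp (nerve U) n → R) →ₗ[R] (nerveDoubleComplex U A).T n :=
  (nerveDoubleComplex U A).incl n 0 rfl ∘ₗ
    (LinearMap.pi fun σ => A.aug (inter U σ.1) ∘ₗ LinearMap.proj σ :
      (Simp (nerve U) n → R) →ₗ[R] nerveCochains U A n 0)

/-- `τ_A` in degree `n`: an element `a` of `A^n(X)` goes to the element of `C⁰(N, A^n)` with
components `a | |σ|`. -/
def tauMap (n : ℕ) : A.cochains n Set.univ →ₗ[R] (nerveDoubleComplex U A).T n :=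
  (nerveDoubleComplex U A).incl 0 n (zero_add n) ∘ₗ
    (LinearMap.pi fun σ => A.res n (Set.subset_univ (inter U σ.1)) :
      A.cochains n Set.univ →ₗ[R] nerveCochains U A 0 n)

lemma nerveD_aug (n : ℕ) (c : Simp (nerve U) n → R) :
    nerveD U A n 0 (fun σ => A.aug (inter U σ.1) (c σ)) = 0 := by
  funext σ
  exact A.d_aug _ _

lemma nerveDelta_aug (n : ℕ) (c : Simp (nerve U) n → R) :
    nerveDelta U A n 0 (fun σ => A.aug (inter U σ.1) (c σ)) =
      fun σ => A.aug (inter U σ.1) (simplicialCoboundary (nerve U) R n c σ) := by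
  funext σ
  rw [nerveDelta_apply, simplicialCoboundary_apply, map_sum]
  refine Finset.sum_congr rfl fun x _ => ?_
  rw [map_zsmul]
  congr 1
  exact A.res_aug _ _

lemma nerveDelta_res (n : ℕ) (a : A.cochains n Set.univ) :
    nerveDelta U A 0 n (fun σ => A.res n (Set.subset_univ (inter U σ.1)) a) = 0 := by
  funext σ
  rw [nerveDelta_apply]
  simp only [A.res_res]
  change ∑ x : σ.1, ((-1 : ℤ) ^ pos σ.1 x) • A.res n (Set.subset_univ (inter U σ.1)) a = 0
  rw [← Finset.sum_smul]
  obtain ⟨σ, hσ⟩ := σ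
  obtain ⟨y, z, hyz, rfl⟩ : ∃ y z : V, y < z ∧ σ = {y, z} := by
    obtain ⟨y, z, h, rfl⟩ := Finset.card_eq_two.1 hσ.2
    rcases lt_or_gt_of_ne h with h | h
    · exact ⟨y, z, h, rfl⟩
    · exact ⟨z, y, h, Finset.pair_comm _ _⟩
  have hy : pos {y, z} y = 0 := by
    simp [pos, Finset.filter_insert, Finset.filter_singleton, hyz.le]
  have hz : pos {y, z} z = 1 := by
    simp [pos, Finset.filter_insert, Finset.filter_singleton, hyz]
  have : ∑ x : ({y, z} : Finset V), (-1 : ℤ) ^ pos {y, z} x.1 = 0 := by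
    rw [Finset.sum_coe_sort {y, z} (fun x => (-1 : ℤ) ^ pos {y, z} x),
      Finset.sum_pair hyz.ne, hy, hz]
    norm_num
  exact (congrArg (· • _) this).trans (zero_smul _ _)

lemma D_lambdaMap (n : ℕ) (c : Simp (nerve U) n → R) :
    (nerveDoubleComplex U A).D n (lambdaMap U A n c) =
      lambdaMap U A (n + 1) (simplicialCoboundary (nerve U) R n c) := by
  refine ((nerveDoubleComplex U A).D_incl n 0 rfl _).trans ?_
  change (nerveDoubleComplex U A).incl (n + 1) 0 _
      (nerveDelta U A n 0 (fun σ => A.aug (inter U σ.1) (c σ))) +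
    _ • (nerveDoubleComplex U A).incl n 1 _
      (nerveD U A n 0 (fun σ => A.aug (inter U σ.1) (c σ))) = _
  rw [nerveD_aug, nerveDelta_aug]
  erw [map_zero]
  rw [smul_zero]
  exact add_zero _

lemma D_tauMap (n : ℕ) (a : A.cochains n Set.univ) :
    (nerveDoubleComplex U A).D n (tauMap U A n a) =
      tauMap U A (n + 1) (A.diff n Set.univ a) := by
  refine ((nerveDoubleComplex U A).D_incl 0 n (zero_add n) _).trans ?_
  change (nerveDoubleComplex U A).incl 1 n _
      (nerveDelta U A 0 n (fun σ => A.res n (Set.subset_univ (inter U σ.1)) a)) +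
    _ • (nerveDoubleComplex U A).incl 0 (n + 1) _
      (nerveD U A 0 n (fun σ => A.res n (Set.subset_univ (inter U σ.1)) a)) = _
  rw [nerveDelta_res]
  erw [map_zero]
  rw [zero_add, pow_zero, one_smul]
  refine congrArg ((nerveDoubleComplex U A).incl 0 (n + 1) _) ?_
  funext σ
  exact A.diff_res _ _ _

/-- The morphism of complexes `λ_A : C^•(N) → T^•(N, A)`. -/
def lambda : simplicialCochains (nerve U) R ⟶ nerveTotal U A :=
  CochainComplex.ofHom (fun n => ModuleCat.ofHom (lambdaMap U A n)) (by
    intro n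
    simp only [simplicialCochains, nerveTotal, DoubleComplex.total, CochainComplex.of_d]
    exact ModuleCat.hom_ext (LinearMap.ext fun c => D_lambdaMap U A n c))

/-- The morphism of complexes `τ_A : A^•(X) → T^•(N, A)`, where the augmentation term of
`A^•(X)` is omitted. -/
def tau : A.functor.obj (op Set.univ) ⟶ nerveTotal U A where
  f n := ModuleCat.ofHom (tauMap U A n)
  comm' := by
    rintro n _ rfl
    simp only [nerveTotal, DoubleComplex.total, CochainComplex.of_d]
    exact ModuleCat.hom_ext (LinearMap.ext fun a => D_tauMap U A n a)

end Covering

/-! ### Singular cochains -/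

section Singular

variable (X : Type u) [TopologicalSpace X] (R : Type v) [Ring R]

/-- The functor sending a subset of `X` to the corresponding subspace. -/
def subspaceFunctor : Set X ⥤ TopCat.{u} where
  obj Z := TopCat.of Z
  map f := TopCat.ofHom ⟨Set.inclusion (leOfHom f), continuous_inclusion (leOfHom f)⟩

/-- The contravariant functor sending a set `S` to the module of all functions `S → R`. -/
def functionsModule : (Type u)ᵒᵖ ⥤ ModuleCat.{max u v} R where
  obj S := ModuleCat.of R (S.unop → R)
  map f := ModuleCat.ofHom (LinearMap.funLeft R R f.unop)

/-- The complex of singular cochains: `C^q` consists of all functions from the set of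
singular `q`-simplices to `R`, and `d = ∑ᵢ (-1)ⁱ ∂ᵢ^*`. -/
def singularCochainComplex : TopCat.{u}ᵒᵖ ⥤ CochainComplex (ModuleCat.{max u v} R) ℕ :=
  TopCat.toSSet.op ⋙
    { obj := fun S => S.unop.rightOp ⋙ functionsModule R
      map := fun f => Functor.whiskerRight (NatTrans.rightOp f.unop) (functionsModule R) } ⋙
    AlgebraicTopology.alternatingCofaceMapComplex (ModuleCat.{max u v} R)

/-- The functor `Z ↦ C^•(Z)` of singular cochains of subspaces `Z` of `X`, augmented by sending
`r` to the cochain which is equal to `r` on all singular `0`-simplices. -/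
def singularCochains : CochainFunctor.{u, v, max u v} X R where
  functor := (subspaceFunctor X).op ⋙ singularCochainComplex R
  aug Z := (LinearMap.pi fun _ => LinearMap.id :
    R →ₗ[R] ((TopCat.toSSet.obj (TopCat.of Z)).obj (op (SimplexCategory.mk 0)) → R))
  d_aug Z r := by
    let Y : CosimplicialObject (ModuleCat.{max u v} R) :=
      (TopCat.toSSet.obj (TopCat.of Z)).rightOp ⋙ functionsModule R
    have h : (AlgebraicTopology.AlternatingCofaceMapComplex.obj Y).d 0 1 = Y.δ 0 + -Y.δ 1 := by
      refine (CochainComplex.of_d (fun n => Y.obj (SimplexCategory.mk n))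
        (AlgebraicTopology.AlternatingCofaceMapComplex.objD Y) 0).trans ?_
      simp [Fin.sum_univ_two]
      rfl
    refine (congrArg (fun f => f.hom (fun _ => r)) h).trans ?_
    exact add_neg_cancel (fun _ => r)
  res_aug h r := rfl

end Singular

/-! ### The canonical homomorphism `l_U` -/

section LerayMap

open HomologicalComplex

variable {X : Type u} [TopologicalSpace X] {V : Type u} [LinearOrder V] (U : V → Set X)
  (R : Type v) [Ring R]

/-- The cohomology `H^n(K)` of a simplicial complex `K` with coefficients in `R`. -/
abbrev simplicialCohomology (K : PreAbstractSimplicialComplex V) (n : ℕ) :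
    ModuleCat.{max u v} R :=
  (simplicialCochains K R).homology n

/-- The singular cohomology `H^n(X)` of `X` with coefficients in `R`. -/
abbrev singularCohomology (X : Type u) [TopologicalSpace X] (n : ℕ) : ModuleCat.{max u v} R :=
  (singularCochains X R).cohomology n Set.univ

/-- The homomorphism `λ_{C*} : H^n(N) → H^n(N, C)`. -/
def lambdaC (n : ℕ) : simplicialCohomology R (nerve U) n ⟶
    (nerveTotal U (singularCochains X R)).homology n :=
  homologyMap (lambda U (singularCochains X R)) n

/-- The homomorphism `τ_{C*} : H^n(X) → H^n(N, C)`. -/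
def tauC (n : ℕ) : singularCohomology R X n ⟶
    (nerveTotal U (singularCochains X R)).homology n :=
  homologyMap (tau U (singularCochains X R)) n

/-- The canonical homomorphism `l_U = τ_{C*}⁻¹ ∘ λ_{C*} : H^n(N) → H^n(X)`, defined when
`τ_{C*}` is an isomorphism. -/
def lerayMap (n : ℕ) (h : IsIso (tauC U R n)) :
    simplicialCohomology R (nerve U) n ⟶ singularCohomology R X n :=
  lambdaC U R n ≫ inv (tauC U R n)

variable {R}

/-- The homomorphism `H_A^n(X) → H^n(X)` induced by a natural transformation `A^• → C^•`. -/
def comparison {A : CochainFunctor.{u, v, max u v} X R}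
    (φ : CochainFunctor.Hom A (singularCochains X R)) (n : ℕ) :
    A.cohomology n Set.univ ⟶ singularCohomology R X n :=
  homologyMap (φ.natTrans.app (op Set.univ)) n

end LerayMap

end Leray

end

noncomputable section

namespace Leray

open Finsupp

/-! Both `λ_A` and `τ_C` are edge homomorphisms of a first quadrant double complex. If the complexes
in the `δ` direction are exact in positive degree, if a complex `B` maps onto the kernel of the
first `δ`, and if the kernel of `B → K^{0,•}` is acyclic, then `B` computes the cohomology of the
total complex: a cocycle is pushed into `K^{0,•}` one component at a time and then lifted to `B`.
This is `DoubleComplex.isIso_homologyMap_edge`, applied twice.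

For `λ_A` the double complex is transposed. Its `δ` is then the differential of the complexes
`A^•(|σ|)`, and acyclicity of the covering is exactly the hypothesis (`isIso_homologyMap_lambda`).

For `τ_C` the nerve direction is used. Fix a singular simplex `s`: the indices `v` with `s` inside
`U v` span a full simplex of the nerve, and coning with one chosen `v` contracts its cochains
(`nerveDelta_exact_succ`, `exists_restriction_eq`). The kernel of restriction to the covering
consists of the cochains vanishing on simplices contained in some `U v`. It is acyclic by
barycentric subdivision: iterated subdivision makes any chain small, so chains modulo small chains
form an acyclic complex of free groups, which therefore contracts, and the contraction dualizes to
cochains with any coefficients (`SingChain.exists_relative_primitive`). Only this step uses that the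
interiors cover `X`.

Finally `φ` induces `T(φ) : T(N, A) → T(N, C)` with `T(φ) λ_A = λ_C` and `T(φ) τ_A = τ_C φ`. Hence
`ψ = λ_A⁻¹ τ_A` in cohomology satisfies `τ_C⁻¹ λ_C ψ = τ_C⁻¹ T(φ) τ_A = φ`.

Chains are indexed by the number of vertices, so that degree `0` is the augmentation term. -/

/-! ### Ordered chains and their barycentric subdivision -/

/-- The augmented ordered chains of a set `P`: formal combinations of `q`-tuples, the `0`-tuple
spanning the augmentation term. -/
abbrev OrdChain (P : Type*) (q : ℕ) : Type _ := (Fin q → P) →₀ ℤ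

namespace OrdChain

variable {P Q : Type*}

/-- The boundary operator, the alternating sum of the faces. -/
def bd (q : ℕ) : OrdChain P (q + 1) →ₗ[ℤ] OrdChain P q :=
  linearCombination ℤ fun v => ∑ i : Fin (q + 1), (-1 : ℤ) ^ (i : ℕ) • single (v ∘ i.succAbove) 1

lemma bd_single (q : ℕ) (v : Fin (q + 1) → P) :
    bd q (single v 1) = ∑ i : Fin (q + 1), (-1 : ℤ) ^ (i : ℕ) • single (v ∘ i.succAbove) 1 := by
  simp [bd]

/-- The cone operator, prepending a vertex to each tuple. -/
def cone (q : ℕ) (b : P) : OrdChain P q →ₗ[ℤ] OrdChain P (q + 1) :=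
  lmapDomain ℤ ℤ fun v => Fin.cons b v

lemma cone_single (q : ℕ) (b : P) (v : Fin q → P) :
    cone q b (single v 1) = single (Fin.cons b v) 1 := by
  simp [cone]

lemma bd_cone_zero (b : P) (z : OrdChain P 0) : bd 0 (cone 0 b z) = z := by
  suffices bd 0 ∘ₗ cone 0 b = LinearMap.id from LinearMap.congr_fun this z
  refine lhom_ext' fun v => LinearMap.ext_ring ?_
  simp only [LinearMap.comp_apply, lsingle_apply, cone_single, bd_single, LinearMap.id_apply]
  simp only [Nat.reduceAdd, Finset.univ_unique, Finset.sum_singleton]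
  simp [Subsingleton.elim _ v]

/-- Deleting the apex returns the tuple; deleting another vertex shifts the index by one and so
changes the sign. Coning thus contracts the augmented complex, and this identity drives all later
inductions. -/
lemma bd_cone (q : ℕ) (b : P) (z : OrdChain P (q + 1)) :
    bd (q + 1) (cone (q + 1) b z) = z - cone q b (bd q z) := by
  suffices bd (q + 1) ∘ₗ cone (q + 1) b = LinearMap.id - cone q b ∘ₗ bd q from
    LinearMap.congr_fun this z
  refine lhom_ext' fun v => LinearMap.ext_ring ?_
  simp only [LinearMap.comp_apply, lsingle_apply, cone_single, bd_single, LinearMap.id_apply,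
    LinearMap.sub_apply, map_sum, map_zsmul]
  rw [Fin.sum_univ_succ, sub_eq_add_neg, ← Finset.sum_neg_distrib]
  congr 1
  · simp only [Fin.val_zero, pow_zero, one_smul]
    congr 1
  · refine Finset.sum_congr rfl fun i _ => ?_
    rw [← neg_smul]
    congr 1
    · simp [pow_succ]
    · congr 1
      funext j
      refine Fin.cases ?_ (fun j => ?_) j <;> simp

/-- Every non-empty tuple is the cone over its tail, so the cone formula and induction replace the
cancellation in a double sum. -/
lemma bd_bd (q : ℕ) (z : OrdChain P (q + 2)) : bd q (bd (q + 1) z) = 0 := by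
  induction q with
  | zero =>
    suffices bd 0 ∘ₗ bd 1 = (0 : OrdChain P 2 →ₗ[ℤ] _) from LinearMap.congr_fun this z
    refine lhom_ext' fun v => LinearMap.ext_ring ?_
    simp only [LinearMap.comp_apply, lsingle_apply]
    obtain ⟨b, w, rfl⟩ : ∃ b w, v = Fin.cons b w := ⟨v 0, Fin.tail v, (Fin.cons_self_tail v).symm⟩
    rw [← cone_single, bd_cone, map_sub, bd_cone_zero, sub_self]; rfl
  | succ q ih =>
    suffices bd (q + 1) ∘ₗ bd (q + 2) = (0 : OrdChain P (q + 3) →ₗ[ℤ] _) from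
      LinearMap.congr_fun this z
    refine lhom_ext' fun v => LinearMap.ext_ring ?_
    simp only [LinearMap.comp_apply, lsingle_apply]
    obtain ⟨b, w, rfl⟩ : ∃ b w, v = Fin.cons b w := ⟨v 0, Fin.tail v, (Fin.cons_self_tail v).symm⟩
    rw [← cone_single, bd_cone, map_sub, bd_cone, ih, map_zero, sub_zero, sub_self]; rfl

/-- The map of chains induced by a map of vertices. -/
def map (f : P → Q) (q : ℕ) : OrdChain P q →ₗ[ℤ] OrdChain Q q :=
  lmapDomain ℤ ℤ fun v => f ∘ v

lemma map_single (f : P → Q) (q : ℕ) (v : Fin q → P) :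
    map f q (single v 1) = single (f ∘ v) 1 := by
  simp [map]

lemma bd_map (f : P → Q) (q : ℕ) (z : OrdChain P (q + 1)) :
    bd q (map f (q + 1) z) = map f q (bd q z) := by
  suffices bd q ∘ₗ map f (q + 1) = map f q ∘ₗ bd q from LinearMap.congr_fun this z
  refine lhom_ext' fun v => LinearMap.ext_ring ?_
  simp only [LinearMap.comp_apply, lsingle_apply, map_single, bd_single, map_sum, map_zsmul]
  rfl

lemma cone_map (f : P → Q) (q : ℕ) (b : P) (z : OrdChain P q) :
    cone q (f b) (map f q z) = map f (q + 1) (cone q b z) := by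
  suffices cone q (f b) ∘ₗ map f q = map f (q + 1) ∘ₗ cone q b from LinearMap.congr_fun this z
  refine lhom_ext' fun v => LinearMap.ext_ring ?_
  simp only [LinearMap.comp_apply, lsingle_apply, map_single, cone_single]
  congr 1
  funext j
  refine Fin.cases ?_ (fun j => ?_) j <;> simp

/-! ### Subdivision and its homotopy, built by coning from barycenters -/

section Subdivision

variable (bary : ∀ q : ℕ, (Fin (q + 1) → P) → P) (bary' : ∀ q : ℕ, (Fin (q + 1) → Q) → Q)

/-- The subdivision operator defined by a choice of barycenters. -/
def sd : ∀ q : ℕ, OrdChain P q →ₗ[ℤ] OrdChain P q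
  | 0 => LinearMap.id
  | q + 1 => linearCombination ℤ fun v => cone q (bary q v) (sd q (bd q (single v 1)))

/-- The homotopy between the identity and the subdivision operator. -/
def sdHomotopy : ∀ q : ℕ, OrdChain P q →ₗ[ℤ] OrdChain P (q + 1)
  | 0 => 0
  | q + 1 => linearCombination ℤ fun v =>
      cone (q + 1) (bary q v) (single v 1 - sdHomotopy q (bd q (single v 1)))

lemma sd_single (q : ℕ) (v : Fin (q + 1) → P) :
    sd bary (q + 1) (single v 1) = cone q (bary q v) (sd bary q (bd q (single v 1))) := by
  simp [sd]

lemma sdHomotopy_single (q : ℕ) (v : Fin (q + 1) → P) :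
    sdHomotopy bary (q + 1) (single v 1) =
      cone (q + 1) (bary q v) (single v 1 - sdHomotopy bary q (bd q (single v 1))) := by
  simp [sdHomotopy]

/-- The subdivided boundary is a cycle by induction, so the correction term in the boundary of its
cone vanishes. -/
lemma bd_sd (q : ℕ) (z : OrdChain P (q + 1)) :
    bd q (sd bary (q + 1) z) = sd bary q (bd q z) := by
  induction q with
  | zero =>
    suffices bd 0 ∘ₗ sd bary 1 = sd bary 0 ∘ₗ bd 0 from LinearMap.congr_fun this z
    refine lhom_ext' fun v => LinearMap.ext_ring ?_
    simp only [LinearMap.comp_apply, lsingle_apply]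
    rw [sd_single, bd_cone_zero]
  | succ q ih =>
    suffices bd (q + 1) ∘ₗ sd bary (q + 2) = sd bary (q + 1) ∘ₗ bd (q + 1) from
      LinearMap.congr_fun this z
    refine lhom_ext' fun v => LinearMap.ext_ring ?_
    simp only [LinearMap.comp_apply, lsingle_apply]
    rw [sd_single, bd_cone, ih, bd_bd, map_zero, map_zero, sub_zero]

/-- By induction `v - T(∂v)` has boundary `sd(∂v)`, where `T` is the homotopy. Its cone therefore
has boundary `v - T(∂v)` minus the cone over `sd(∂v)`, which is `sd v`. -/
lemma bd_sdHomotopy (q : ℕ) (z : OrdChain P (q + 1)) :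
    bd (q + 1) (sdHomotopy bary (q + 1) z) =
      z - sd bary (q + 1) z - sdHomotopy bary q (bd q z) := by
  induction q with
  | zero =>
    suffices bd 1 ∘ₗ sdHomotopy bary 1 =
        LinearMap.id - sd bary 1 - sdHomotopy bary 0 ∘ₗ bd 0 from LinearMap.congr_fun this z
    refine lhom_ext' fun v => LinearMap.ext_ring ?_
    simp only [LinearMap.comp_apply, lsingle_apply, LinearMap.sub_apply, LinearMap.id_apply]
    rw [sdHomotopy_single, bd_cone, sd_single]
    simp [sdHomotopy, sd]
  | succ q ih =>
    suffices bd (q + 2) ∘ₗ sdHomotopy bary (q + 2) =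
        LinearMap.id - sd bary (q + 2) - sdHomotopy bary (q + 1) ∘ₗ bd (q + 1) from
      LinearMap.congr_fun this z
    refine lhom_ext' fun v => LinearMap.ext_ring ?_
    simp only [LinearMap.comp_apply, lsingle_apply, LinearMap.sub_apply, LinearMap.id_apply]
    rw [sdHomotopy_single, bd_cone, sd_single, map_sub, ih, bd_bd, map_zero, sub_zero,
      sub_sub_cancel]
    abel

variable {bary bary'} {f : P → Q}

/-- The barycenters are the only choice in the construction, so a vertex map respecting them
respects subdivision. -/
lemma sd_map (hf : ∀ q v, bary' q (f ∘ v) = f (bary q v)) (q : ℕ) (z : OrdChain P q) :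
    sd bary' q (map f q z) = map f q (sd bary q z) := by
  induction q with
  | zero => rfl
  | succ q ih =>
    suffices sd bary' (q + 1) ∘ₗ map f (q + 1) = map f (q + 1) ∘ₗ sd bary (q + 1) from
      LinearMap.congr_fun this z
    refine lhom_ext' fun v => LinearMap.ext_ring ?_
    simp only [LinearMap.comp_apply, lsingle_apply]
    rw [map_single, sd_single, sd_single, hf, ← cone_map, ← ih, ← bd_map, map_single]

lemma sdHomotopy_map (hf : ∀ q v, bary' q (f ∘ v) = f (bary q v)) (q : ℕ) (z : OrdChain P q) :
    sdHomotopy bary' q (map f q z) = map f (q + 1) (sdHomotopy bary q z) := by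
  induction q with
  | zero => simp [sdHomotopy]
  | succ q ih =>
    suffices sdHomotopy bary' (q + 1) ∘ₗ map f (q + 1) =
        map f (q + 2) ∘ₗ sdHomotopy bary (q + 1) from LinearMap.congr_fun this z
    refine lhom_ext' fun v => LinearMap.ext_ring ?_
    simp only [LinearMap.comp_apply, lsingle_apply]
    rw [map_single, sdHomotopy_single, sdHomotopy_single, hf, ← cone_map, map_sub (map f (q + 1)), ← ih, ← bd_map,
      map_single]

end Subdivision

end OrdChain

/-! ### Affine simplices in the standard simplices -/

/-- The standard topological simplex with `q` vertices. -/
abbrev Splx (q : ℕ) : Type := stdSimplex ℝ (Fin q)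

/-- The affine simplex with given vertices. -/
def aff {q m : ℕ} (v : Fin q → Splx m) : C(Splx q, Splx m) where
  toFun t := ⟨∑ i, t.1 i • (v i).1, (convex_stdSimplex ℝ (Fin m)).sum_mem
    (fun i _ => t.2.1 i) t.2.2 (fun i _ => (v i).2)⟩
  continuous_toFun := by
    refine Continuous.subtype_mk ?_ _
    exact continuous_finsetSum _ fun i _ =>
      ((continuous_apply i).comp continuous_subtype_val).smul continuous_const

lemma aff_coe {q m : ℕ} (v : Fin q → Splx m) (t : Splx q) :
    (aff v t).1 = ∑ i, t.1 i • (v i).1 := rfl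

/-- The vertices of the standard simplex. -/
def vert (q : ℕ) (i : Fin q) : Splx q := stdSimplex.vertex i

lemma aff_vert {q m : ℕ} (v : Fin q → Splx m) (i : Fin q) : aff v (vert q i) = v i := by
  apply Subtype.ext
  rw [aff_coe, Finset.sum_eq_single i]
  · simp [vert]
  · intro j _ hj
    simp [vert, Pi.single_eq_of_ne hj]
  · simp

lemma aff_comp_vert {q m : ℕ} (v : Fin q → Splx m) : aff v ∘ vert q = v :=
  funext (aff_vert v)

lemma aff_comp {q m n : ℕ} (v : Fin m → Splx n) (w : Fin q → Splx m) :
    (aff v).comp (aff w) = aff (aff v ∘ w) := by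
  ext1 t
  apply Subtype.ext
  change ∑ i, (aff w t).1 i • (v i).1 = ∑ j, t.1 j • ∑ i, (w j).1 i • (v i).1
  simp only [aff_coe, Finset.sum_apply, Pi.smul_apply, Finset.sum_smul, Finset.smul_sum, smul_smul]
  rw [Finset.sum_comm]
  rfl

lemma aff_aff {q m n : ℕ} (v : Fin m → Splx n) (w : Fin q → Splx m) (t : Splx q) :
    aff v (aff w t) = aff (aff v ∘ w) t :=
  DFunLike.congr_fun (aff_comp v w) t

lemma aff_vert_id (q : ℕ) : aff (vert q) = ContinuousMap.id (Splx q) := by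
  ext1 t
  apply Subtype.ext
  funext j
  simp [aff_coe, vert, Finset.sum_apply, Pi.single_apply]

/-- Matches affine faces with the structure maps of the singular simplicial set. -/
lemma aff_vert_comp {q m : ℕ} (f : Fin q → Fin m) (t : Splx q) :
    aff (vert m ∘ f) t = stdSimplex.map f t := by
  apply Subtype.ext
  funext j
  change (aff (vert m ∘ f) t).1 j = FunOnFinite.linearMap ℝ ℝ f t j
  rw [FunOnFinite.linearMap_apply_apply]
  simp only [aff_coe, Finset.sum_apply, Pi.smul_apply, Function.comp_apply, smul_eq_mul, vert,
    Pi.single_apply, mul_ite, mul_one, mul_zero, Finset.sum_filter, eq_comm (a := j)]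
  rfl

/-- The barycenter of an affine simplex. -/
def bary (m q : ℕ) (v : Fin (q + 1) → Splx m) : Splx m := aff v stdSimplex.barycenter

lemma bary_aff {m n : ℕ} (f : Fin m → Splx n) (q : ℕ) (v : Fin (q + 1) → Splx m) :
    bary n q (aff f ∘ v) = aff f (bary m q v) :=
  (aff_aff f v _).symm

/-- Closed balls are convex. -/
lemma dist_aff_le {q m : ℕ} (v : Fin q → Splx m) (x : Splx m) {r : ℝ}
    (h : ∀ i, dist (v i) x ≤ r) (t : Splx q) : dist (aff v t) x ≤ r :=
  (convex_closedBall x.1 r).sum_mem (fun i _ => t.2.1 i) t.2.2 (fun i _ => h i)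

/-- The difference of the barycenter and `v j` is the mean of the `q + 1` vectors `v i - v j`, one
of which is zero; this gives the factor `q / (q + 1)`. Weakening it to `N / (N + 1)` makes one
factor serve all faces in the induction below. -/
lemma dist_bary_le {q m N : ℕ} (hq : q ≤ N) (v : Fin (q + 1) → Splx m) {r : ℝ}
    (h : ∀ i j, dist (v i) (v j) ≤ r) (j : Fin (q + 1)) :
    dist (v j) (bary m q v) ≤ (N : ℝ) / (N + 1) * r := by
  have hr : 0 ≤ r := dist_nonneg.trans (h j j)
  have hb : (bary m q v).1 - (v j).1 = ((q : ℝ) + 1)⁻¹ • ∑ i, ((v i).1 - (v j).1) := by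
    rw [Finset.sum_sub_distrib, Finset.sum_const, smul_sub, Finset.smul_sum]
    congr 1
    · simp only [bary, aff_coe]
      refine Finset.sum_congr rfl fun i _ => ?_
      congr 1
      change ((Fintype.card (Fin (q + 1)) : ℝ))⁻¹ = _
      simp
    · rw [Finset.card_univ, Fintype.card_fin, ← Nat.cast_smul_eq_nsmul ℝ, smul_smul]
      push_cast
      rw [inv_mul_cancel₀ (by positivity), one_smul]
  rw [dist_comm, Subtype.dist_eq, dist_eq_norm, hb, norm_smul, Real.norm_of_nonneg (by positivity)]
  have h1 : ‖∑ i, ((v i).1 - (v j).1)‖ ≤ q * r := by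
    rw [← Finset.add_sum_erase _ _ (Finset.mem_univ j), sub_self, zero_add]
    refine (norm_sum_le _ _).trans ?_
    refine (Finset.sum_le_card_nsmul _ _ r fun i _ => ?_).trans ?_
    · rw [← dist_eq_norm]; exact h i j
    · simp
  calc ((q : ℝ) + 1)⁻¹ * ‖∑ i, ((v i).1 - (v j).1)‖ ≤ ((q : ℝ) + 1)⁻¹ * (q * r) := by gcongr
    _ = (q : ℝ) / (q + 1) * r := by ring
    _ ≤ (N : ℝ) / (N + 1) * r := by
      refine mul_le_mul_of_nonneg_right ?_ hr
      rw [div_le_div_iff₀ (by positivity) (by positivity)]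
      have : (q : ℝ) ≤ N := by exact_mod_cast hq
      nlinarith

/-- The chains of affine simplices in `Splx m` of mesh at most `r`. -/
def fine (m q : ℕ) (r : ℝ) : Submodule ℤ (OrdChain (Splx m) q) :=
  supported ℤ ℤ {w | ∀ i j, dist (w i) (w j) ≤ r}

lemma linearMap_mem_of_mem_supported {α M : Type*} [AddCommGroup M] {s : Set α}
    {F : (α →₀ ℤ) →ₗ[ℤ] M} {p : Submodule ℤ M} (h : ∀ a ∈ s, F (single a 1) ∈ p)
    {z : α →₀ ℤ} (hz : z ∈ supported ℤ ℤ s) : F z ∈ p := by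
  rw [supported_eq_span_single] at hz
  have : Submodule.span ℤ ((fun a => single a (1 : ℤ)) '' s) ≤ p.comap F := by
    rw [Submodule.span_le]
    rintro _ ⟨a, ha, rfl⟩
    exact h a ha
  exact this hz

/-- The subdivision of an affine simplex consists of simplices contained in it, with a smaller
mesh. -/
lemma sd_single_mem {m N : ℕ} (q : ℕ) (hq : q ≤ N + 1) (v : Fin q → Splx m) {r : ℝ}
    (h : ∀ i j, dist (v i) (v j) ≤ r) :
    OrdChain.sd (bary m) q (single v 1) ∈ supported ℤ ℤ
      {w : Fin q → Splx m | (∀ i j, dist (w i) (w j) ≤ (N : ℝ) / (N + 1) * r) ∧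
        ∀ i, w i ∈ Set.range (aff v)} := by
  induction q with
  | zero => exact single_mem_supported ℤ _ ⟨fun i => i.elim0, fun i => i.elim0⟩
  | succ q ih =>
    rw [OrdChain.sd_single, OrdChain.bd_single, map_sum, map_sum]
    refine Submodule.sum_mem _ fun k _ => ?_
    rw [map_zsmul, map_zsmul]
    refine Submodule.smul_mem _ _ ?_
    refine linearMap_mem_of_mem_supported ?_
      (ih (by omega) (v ∘ k.succAbove) (fun i j => h _ _))
    rintro w ⟨hw1, hw2⟩
    rw [OrdChain.cone_single]
    -- The subdivided face lies in the face, hence in the simplex. The range condition is carried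
    -- through the induction to bound distances to the new apex.
    have hr : ∀ i, w i ∈ Set.range (aff v) := by
      intro i
      obtain ⟨t, ht⟩ := hw2 i
      refine ⟨aff (vert (q + 1) ∘ k.succAbove) t, ?_⟩
      rw [aff_aff, ← ht, ← Function.comp_assoc, aff_comp_vert]
    -- The ball around the barycenter contains the vertices of `v`, hence by convexity all of its
    -- points.
    have hd : ∀ i, dist (w i) (bary m q v) ≤ (N : ℝ) / (N + 1) * r := by
      intro i
      obtain ⟨t, ht⟩ := hr i
      rw [← ht]
      exact dist_aff_le v _ (dist_bary_le (by omega) v h) t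
    refine single_mem_supported ℤ _ ⟨fun i j => ?_, fun i => ?_⟩
    · have h0 : 0 ≤ (N : ℝ) / (N + 1) * r := by
        have : 0 ≤ r := dist_nonneg.trans (h 0 0)
        positivity
      refine Fin.cases ?_ (fun i => ?_) i <;> refine Fin.cases ?_ (fun j => ?_) j
      · simpa using h0
      · simpa [dist_comm] using hd j
      · simpa using hd i
      · simpa using hw1 i j
    · refine Fin.cases ?_ (fun i => ?_) i
      · exact ⟨_, rfl⟩
      · simpa using hr i

lemma sd_mem_fine {m q N : ℕ} (hq : q ≤ N + 1) {r : ℝ} {z : OrdChain (Splx m) q}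
    (hz : z ∈ fine m q r) : OrdChain.sd (bary m) q z ∈ fine m q ((N : ℝ) / (N + 1) * r) :=
  linearMap_mem_of_mem_supported
    (fun v hv => supported_mono (fun _ hw => hw.1) (sd_single_mem q hq v hv)) hz

lemma sd_pow_mem_fine (m q k : ℕ) {r : ℝ} {z : OrdChain (Splx m) q} (hz : z ∈ fine m q r) :
    (OrdChain.sd (bary m) q ^ k) z ∈ fine m q (((q : ℝ) / (q + 1)) ^ k * r) := by
  induction k with
  | zero => simpa using hz
  | succ k ih =>
    rw [pow_succ' (OrdChain.sd (bary m) q), pow_succ' ((q : ℝ) / (q + 1)), mul_assoc]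
    exact sd_mem_fine (by omega) ih

/-! ### Singular chains and small simplices -/

/-- The augmented singular chains with integer coefficients, indexed by the number of vertices. -/
abbrev SingChain (Y : Type*) [TopologicalSpace Y] (q : ℕ) : Type _ := C(Splx q, Y) →₀ ℤ

namespace SingChain

variable {Y : Type*} [TopologicalSpace Y]

/-- The chain map from affine chains to singular chains given by a singular simplex. -/
def push {m : ℕ} (s : C(Splx m, Y)) (q : ℕ) : OrdChain (Splx m) q →ₗ[ℤ] SingChain Y q :=
  lmapDomain ℤ ℤ fun v => s.comp (aff v)

lemma push_single {m : ℕ} (s : C(Splx m, Y)) (q : ℕ) (v : Fin q → Splx m) :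
    push s q (single v 1) = single (s.comp (aff v)) 1 := by
  simp [push]

lemma push_vert {q : ℕ} (s : C(Splx q, Y)) : push s q (single (vert q) 1) = single s 1 := by
  rw [push_single, aff_vert_id, ContinuousMap.comp_id]

lemma push_comp_aff {m n : ℕ} (s : C(Splx m, Y)) (v : Fin n → Splx m) (q : ℕ)
    (z : OrdChain (Splx n) q) :
    push (s.comp (aff v)) q z = push s q (OrdChain.map (aff v) q z) := by
  suffices push (s.comp (aff v)) q = push s q ∘ₗ OrdChain.map (aff v) q from
    LinearMap.congr_fun this z
  refine lhom_ext' fun w => LinearMap.ext_ring ?_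
  simp only [LinearMap.comp_apply, lsingle_apply, OrdChain.map_single, push_single,
    ContinuousMap.comp_assoc, aff_comp]

/-- The operator on singular chains induced by a natural operator on affine chains. -/
def ind {q r : ℕ} (F : ∀ m, OrdChain (Splx m) q →ₗ[ℤ] OrdChain (Splx m) r) :
    SingChain Y q →ₗ[ℤ] SingChain Y r :=
  linearCombination ℤ fun s => push s r (F q (single (vert q) 1))

lemma ind_single {q r : ℕ} (F : ∀ m, OrdChain (Splx m) q →ₗ[ℤ] OrdChain (Splx m) r)
    (s : C(Splx q, Y)) : ind F (single s 1) = push s r (F q (single (vert q) 1)) := by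
  simp [ind]

/-- An operator on affine chains is natural if it commutes with affine maps. -/
def IsNatural {q r : ℕ} (F : ∀ m, OrdChain (Splx m) q →ₗ[ℤ] OrdChain (Splx m) r) : Prop :=
  ∀ (m n : ℕ) (f : Fin m → Splx n) (z : OrdChain (Splx m) q),
    F n (OrdChain.map (aff f) q z) = OrdChain.map (aff f) r (F m z)

/-- An affine simplex is the image of the universal one `vert q` under `aff v`, so naturality
reduces the claim to the definition of `ind`. -/
lemma IsNatural.ind_push {q r : ℕ} {F : ∀ m, OrdChain (Splx m) q →ₗ[ℤ] OrdChain (Splx m) r}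
    (hF : IsNatural F) {m : ℕ} (s : C(Splx m, Y)) (z : OrdChain (Splx m) q) :
    ind F (push s q z) = push s r (F m z) := by
  suffices ind F ∘ₗ push s q = push s r ∘ₗ F m from LinearMap.congr_fun this z
  refine lhom_ext' fun v => LinearMap.ext_ring ?_
  simp only [LinearMap.comp_apply, lsingle_apply, push_single]
  rw [ind_single, push_comp_aff, ← hF, OrdChain.map_single, aff_comp_vert]

lemma isNatural_bd (q : ℕ) : IsNatural fun _ => OrdChain.bd q :=
  fun _ _ _ z => OrdChain.bd_map _ q z

lemma isNatural_sd (q : ℕ) : IsNatural fun m => OrdChain.sd (bary m) q :=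
  fun _ _ f z => OrdChain.sd_map (bary_aff f) q z

lemma isNatural_sdHomotopy (q : ℕ) : IsNatural fun m => OrdChain.sdHomotopy (bary m) q :=
  fun _ _ f z => OrdChain.sdHomotopy_map (bary_aff f) q z

variable (Y) in
/-- The boundary operator on singular chains. -/
def bd (q : ℕ) : SingChain Y (q + 1) →ₗ[ℤ] SingChain Y q := ind fun _ => OrdChain.bd q

variable (Y) in
/-- The barycentric subdivision of singular chains. -/
def sd (q : ℕ) : SingChain Y q →ₗ[ℤ] SingChain Y q := ind fun m => OrdChain.sd (bary m) q

variable (Y) in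
/-- The homotopy between the identity and the barycentric subdivision. -/
def sdHomotopy (q : ℕ) : SingChain Y q →ₗ[ℤ] SingChain Y (q + 1) :=
  ind fun m => OrdChain.sdHomotopy (bary m) q

lemma bd_push (q : ℕ) {m : ℕ} (s : C(Splx m, Y)) (z : OrdChain (Splx m) (q + 1)) :
    bd Y q (push s (q + 1) z) = push s q (OrdChain.bd q z) :=
  (isNatural_bd q).ind_push s z

lemma sd_push (q : ℕ) {m : ℕ} (s : C(Splx m, Y)) (z : OrdChain (Splx m) q) :
    sd Y q (push s q z) = push s q (OrdChain.sd (bary m) q z) :=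
  (isNatural_sd q).ind_push s z

lemma sdHomotopy_push (q : ℕ) {m : ℕ} (s : C(Splx m, Y)) (z : OrdChain (Splx m) q) :
    sdHomotopy Y q (push s q z) = push s (q + 1) (OrdChain.sdHomotopy (bary m) q z) :=
  (isNatural_sdHomotopy q).ind_push s z

lemma bd_single (q : ℕ) (s : C(Splx (q + 1), Y)) :
    bd Y q (single s 1) = ∑ i : Fin (q + 1),
      (-1 : ℤ) ^ (i : ℕ) • single (s.comp (aff (vert (q + 1) ∘ i.succAbove))) 1 := by
  rw [← push_vert, bd_push, OrdChain.bd_single, map_sum]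
  simp only [map_zsmul, push_single]

/-- A singular simplex is the push of the universal affine simplex, so this identity and the next
two are inherited from affine chains. -/
lemma bd_bd (q : ℕ) (z : SingChain Y (q + 2)) : bd Y q (bd Y (q + 1) z) = 0 := by
  suffices bd Y q ∘ₗ bd Y (q + 1) = 0 from LinearMap.congr_fun this z
  refine lhom_ext' fun s => LinearMap.ext_ring ?_
  simp only [LinearMap.comp_apply, lsingle_apply]
  rw [← push_vert, bd_push, bd_push, OrdChain.bd_bd, map_zero]; rfl

lemma bd_sd (q : ℕ) (z : SingChain Y (q + 1)) :
    bd Y q (sd Y (q + 1) z) = sd Y q (bd Y q z) := by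
  suffices bd Y q ∘ₗ sd Y (q + 1) = sd Y q ∘ₗ bd Y q from LinearMap.congr_fun this z
  refine lhom_ext' fun s => LinearMap.ext_ring ?_
  simp only [LinearMap.comp_apply, lsingle_apply]
  rw [← push_vert, bd_push, sd_push, sd_push, bd_push, OrdChain.bd_sd]

lemma bd_sdHomotopy (q : ℕ) (z : SingChain Y (q + 1)) :
    bd Y (q + 1) (sdHomotopy Y (q + 1) z) =
      z - sd Y (q + 1) z - sdHomotopy Y q (bd Y q z) := by
  suffices bd Y (q + 1) ∘ₗ sdHomotopy Y (q + 1) =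
    LinearMap.id - sd Y (q + 1) - sdHomotopy Y q ∘ₗ bd Y q from LinearMap.congr_fun this z
  refine lhom_ext' fun s => LinearMap.ext_ring ?_
  simp only [LinearMap.comp_apply, lsingle_apply, LinearMap.sub_apply, LinearMap.id_apply]
  rw [← push_vert, bd_push, sd_push, sdHomotopy_push, sdHomotopy_push, bd_push,
    OrdChain.bd_sdHomotopy, map_sub, map_sub]

/-! ### Small chains and the contraction of chains modulo small chains -/

section Small

variable {ι : Type*} (W : ι → Set Y)

/-- The singular simplices contained in a member of the family `W`; the empty simplex is always
considered as small. -/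
def IsSmall (W : ι → Set Y) {q : ℕ} (s : C(Splx q, Y)) : Prop :=
  q = 0 ∨ ∃ i, Set.range s ⊆ W i

/-- The singular chains which are combinations of small simplices. -/
def small (q : ℕ) : Submodule ℤ (SingChain Y q) := supported ℤ ℤ {s | IsSmall W s}

lemma mem_small_zero (z : SingChain Y 0) : z ∈ small W 0 := by
  rw [small, mem_supported]
  exact fun _ _ => Or.inl rfl

variable {W}

/-- Every simplex of the pushed chain factors through `s`. With at least one vertex, smallness of
`s` really provides a member of the family. -/
lemma push_mem_small {m q : ℕ} {s : C(Splx (m + 1), Y)} (hs : IsSmall W s)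
    (z : OrdChain (Splx (m + 1)) q) : push s q z ∈ small W q := by
  obtain ⟨i, hi⟩ := hs.resolve_left (Nat.succ_ne_zero m)
  have : z ∈ supported ℤ ℤ (Set.univ : Set (Fin q → Splx (m + 1))) := by
    rw [supported_univ]; trivial
  refine linearMap_mem_of_mem_supported (fun v _ => ?_) this
  rw [push_single]
  refine single_mem_supported ℤ _ (Or.inr ⟨i, ?_⟩)
  rintro _ ⟨t, rfl⟩
  exact hi ⟨_, rfl⟩

lemma ind_mem_small {q r : ℕ} (F : ∀ m, OrdChain (Splx m) (q + 1) →ₗ[ℤ] OrdChain (Splx m) r)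
    {z : SingChain Y (q + 1)} (hz : z ∈ small W (q + 1)) : ind F z ∈ small W r := by
  refine linearMap_mem_of_mem_supported (fun s hs => ?_) hz
  rw [ind_single]
  exact push_mem_small hs _

lemma sd_mem_small {q : ℕ} {z : SingChain Y q} (hz : z ∈ small W q) : sd Y q z ∈ small W q := by
  cases q with
  | zero => exact mem_small_zero W _
  | succ q => exact ind_mem_small _ hz

lemma sdHomotopy_mem_small {q : ℕ} {z : SingChain Y q} (hz : z ∈ small W q) :
    sdHomotopy Y q z ∈ small W (q + 1) := by
  cases q with
  | zero =>
    have : sdHomotopy Y 0 = 0 := by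
      refine lhom_ext' fun s => LinearMap.ext_ring ?_
      simp [sdHomotopy, ind_single, OrdChain.sdHomotopy]
    rw [this]
    exact zero_mem _
  | succ q => exact ind_mem_small _ hz

lemma sd_pow_push (q k : ℕ) {m : ℕ} (s : C(Splx m, Y)) (z : OrdChain (Splx m) q) :
    (sd Y q ^ k) (push s q z) = push s q ((OrdChain.sd (bary m) q ^ k) z) := by
  induction k with
  | zero => rfl
  | succ k ih =>
    rw [pow_succ' (sd Y q), pow_succ' (OrdChain.sd (bary m) q), Module.End.mul_apply, ih, sd_push]
    rfl

lemma sd_pow_mem_small {q k : ℕ} {z : SingChain Y q} (hz : z ∈ small W q) :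
    (sd Y q ^ k) z ∈ small W q := by
  induction k with
  | zero => exact hz
  | succ k ih => rw [pow_succ' (sd Y q)]; exact sd_mem_small ih

/-- The preimages of the interiors form an open cover of a compact simplex, which has a Lebesgue
number; the mesh of the iterated subdivisions tends to zero. -/
lemma exists_sd_pow_single_mem_small (hW : ⋃ i, interior (W i) = Set.univ) {q : ℕ}
    (s : C(Splx q, Y)) : ∃ k, (sd Y q ^ k) (single s 1) ∈ small W q := by
  cases q with
  | zero => exact ⟨0, mem_small_zero W _⟩
  | succ q =>
    obtain ⟨δ, hδ, H⟩ := lebesgue_number_lemma_of_metric (s := (Set.univ : Set (Splx (q + 1))))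
      isCompact_univ (c := fun i => s ⁻¹' interior (W i))
      (fun i => isOpen_interior.preimage s.continuous) (by
        rw [← Set.preimage_iUnion, hW, Set.preimage_univ])
    -- In the sup metric the standard simplex has diameter at most `1`.
    have hfine : single (vert (q + 1)) 1 ∈ fine (q + 1) (q + 1) (1 : ℝ) := by
      refine single_mem_supported ℤ _ fun i j => ?_
      exact (Metric.dist_le_diam_of_mem (bounded_stdSimplex (Fin (q + 1))) (vert _ i).2
        (vert _ j).2).trans diam_stdSimplex_le
    have hlt : ((q + 1 : ℕ) : ℝ) / ((q + 1 : ℕ) + 1) < 1 := by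
      rw [div_lt_one (by positivity)]; linarith
    obtain ⟨k, hk⟩ := exists_pow_lt_of_lt_one hδ hlt
    refine ⟨k, ?_⟩
    rw [← push_vert, sd_pow_push]
    have := sd_pow_mem_fine (q + 1) (q + 1) k hfine
    refine linearMap_mem_of_mem_supported (fun w hw => ?_) this
    obtain ⟨i, hi⟩ := H (w 0) trivial
    rw [push_single]
    refine single_mem_supported ℤ _ (Or.inr ⟨i, ?_⟩)
    rintro _ ⟨t, rfl⟩
    refine interior_subset (hi (Metric.mem_ball.2 ?_))
    refine (dist_aff_le w (w 0) (fun j => hw j 0) t).trans_lt ?_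
    rwa [mul_one]

lemma exists_sd_pow_mem_small (hW : ⋃ i, interior (W i) = Set.univ) {q : ℕ}
    (z : SingChain Y q) : ∃ k, (sd Y q ^ k) z ∈ small W q := by
  induction z using Finsupp.induction_linear with
  | zero => exact ⟨0, by simp⟩
  | add x y hx hy =>
    obtain ⟨k, hk⟩ := hx
    obtain ⟨l, hl⟩ := hy
    -- Subdividing a small chain keeps it small, so the sum of the exponents serves both summands.
    refine ⟨k + l, ?_⟩
    rw [map_add]
    refine add_mem ?_ ?_
    · rw [add_comm, pow_add]; exact sd_pow_mem_small hk
    · rw [pow_add]; exact sd_pow_mem_small hl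
  | single s a =>
    obtain ⟨k, hk⟩ := exists_sd_pow_single_mem_small hW s
    refine ⟨k, ?_⟩
    rw [← mul_one a, ← smul_eq_mul, ← smul_single, map_smul]
    exact Submodule.smul_mem _ _ hk

/-- A chain whose boundary is small is homologous to a small chain modulo small chains. -/
lemma exists_sub_bd_mem_small (hW : ⋃ i, interior (W i) = Set.univ) {q : ℕ}
    (z : SingChain Y (q + 1)) (hz : bd Y q z ∈ small W q) :
    ∃ w : SingChain Y (q + 2), z - bd Y (q + 1) w ∈ small W (q + 1) := by
  obtain ⟨k, hk⟩ := exists_sd_pow_mem_small hW z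
  induction k generalizing z with
  | zero => exact ⟨0, by simpa using hk⟩
  | succ k ih =>
    obtain ⟨w, hw⟩ := ih (sd Y (q + 1) z) (by rw [bd_sd]; exact sd_mem_small hz)
      (by rwa [pow_succ (sd Y (q + 1))] at hk)
    -- With `T` the homotopy, `z - ∂(w + T z) = (sd z - ∂w) + T(∂z)`, and `T(∂z)` is small because
    -- `∂z` is.
    refine ⟨w + sdHomotopy Y (q + 1) z, ?_⟩
    rw [map_add, bd_sdHomotopy]
    have := add_mem hw (sdHomotopy_mem_small hz)
    convert this using 1
    abel

/-- Chains modulo small chains are free on the simplices that are not small, and acyclic by the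
preceding lemma, so a contraction can be built degree by degree. The second condition says that `z -
h(∂z)` is a boundary modulo small chains; choosing the bounding chain on basis elements gives the
next `h`. -/
lemma exists_contraction (hW : ⋃ i, interior (W i) = Set.univ) (q : ℕ) :
    ∃ h : SingChain Y q →ₗ[ℤ] SingChain Y (q + 1),
      (∀ z ∈ small W q, h z ∈ small W (q + 1)) ∧
      ∀ z : SingChain Y (q + 1), ∃ w : SingChain Y (q + 2),
        z - h (bd Y q z) - bd Y (q + 1) w ∈ small W (q + 1) := by
  induction q with
  | zero =>
    refine ⟨0, fun _ _ => zero_mem _, fun z => ?_⟩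
    obtain ⟨w, hw⟩ := exists_sub_bd_mem_small hW z (mem_small_zero W _)
    exact ⟨w, by simpa using hw⟩
  | succ q ih =>
    classical
    obtain ⟨h, h1, h2⟩ := ih
    choose w hw using h2
    let h' : SingChain Y (q + 1) →ₗ[ℤ] SingChain Y (q + 2) :=
      -- The value `0` on small simplices makes `h'` preserve small chains.
      linearCombination ℤ fun s => if IsSmall W s then 0 else w (single s 1)
    have h'_single (s) : h' (single s 1) = if IsSmall W s then 0 else w (single s 1) := by
      simp [h']
    have key (z : SingChain Y (q + 1)) : z - h (bd Y q z) - bd Y (q + 1) (h' z) ∈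
        small W (q + 1) := by
      have : z ∈ supported ℤ ℤ (Set.univ : Set C(Splx (q + 1), Y)) := by
        rw [supported_univ]; trivial
      refine linearMap_mem_of_mem_supported
        (F := LinearMap.id - h ∘ₗ bd Y q - bd Y (q + 1) ∘ₗ h') (fun s _ => ?_) this
      simp only [LinearMap.sub_apply, LinearMap.comp_apply, LinearMap.id_apply, h'_single]
      split_ifs with hs
      · rw [map_zero, sub_zero]
        have hs' : single s 1 ∈ small W (q + 1) := single_mem_supported ℤ _ hs
        exact sub_mem hs' (h1 _ (ind_mem_small _ hs'))
      · exact hw _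
    refine ⟨h', fun z hz => linearMap_mem_of_mem_supported (fun s hs => ?_) hz, fun z => ?_⟩
    · rw [h'_single, if_pos (show IsSmall W s from hs)]
      exact zero_mem _
    · refine exists_sub_bd_mem_small hW _ ?_
      -- As `∂∂z = 0`, this says that the boundary of `z - h'(∂z)` is small.
      have := key (bd Y (q + 1) z)
      rwa [bd_bd, map_zero, sub_zero, ← map_sub] at this

/-- The relative cochain complex of singular cochains vanishing on small simplices is acyclic. -/
theorem exists_relative_primitive (hW : ⋃ i, interior (W i) = Set.univ) {M : Type*}
    [AddCommGroup M] {q : ℕ} (c : C(Splx (q + 1), Y) → M) (hc : ∀ s, IsSmall W s → c s = 0)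
    (hdc : ∀ s : C(Splx (q + 2), Y), ∑ i : Fin (q + 2),
      (-1 : ℤ) ^ (i : ℕ) • c (s.comp (aff (vert (q + 2) ∘ i.succAbove))) = 0) :
    ∃ b : C(Splx q, Y) → M, (∀ s, IsSmall W s → b s = 0) ∧
      ∀ s : C(Splx (q + 1), Y), c s = ∑ i : Fin (q + 1),
        (-1 : ℤ) ^ (i : ℕ) • b (s.comp (aff (vert (q + 1) ∘ i.succAbove))) := by
  obtain ⟨h, h1, h2⟩ := exists_contraction hW q
  have hsmall : ∀ z ∈ small W (q + 1), linearCombination ℤ c z = 0 := by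
    intro z hz
    have := linearMap_mem_of_mem_supported (F := linearCombination ℤ c) (p := ⊥)
      (fun s hs => by simpa using hc s hs) hz
    simpa using this
  have hbd : ∀ z, linearCombination ℤ c (bd Y (q + 1) z) = 0 := by
    intro z
    suffices linearCombination ℤ c ∘ₗ bd Y (q + 1) = 0 from LinearMap.congr_fun this z
    refine lhom_ext' fun s => LinearMap.ext_ring ?_
    simp only [LinearMap.comp_apply, lsingle_apply, bd_single, map_sum, map_zsmul,
      linearCombination_single, one_smul]
    exact hdc s
  -- The primitive is `c ∘ h`: the cocycle `c` kills boundaries and small chains, hence `c(s) =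
  -- c(h(∂s))`.
  refine ⟨fun s => linearCombination ℤ c (h (single s 1)), fun s hs => ?_, fun s => ?_⟩
  · exact hsmall _ (h1 _ (single_mem_supported ℤ _ hs))
  · obtain ⟨w, hw⟩ := h2 (single s 1)
    have := hsmall _ hw
    rw [map_sub, map_sub, hbd, sub_zero, sub_eq_zero, bd_single] at this
    simpa only [map_sum, map_zsmul, linearCombination_single, one_smul] using this

end Small

end SingChain

/-! ### Singular cochains as functions on continuous maps -/

section

variable {X : Type u} [TopologicalSpace X] {R : Type v} [Ring R]

/-- The value of a singular cochain on a singular simplex. -/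
def evalAt {q : ℕ} {Z : Set X} (s : C(Splx (q + 1), Z)) :
    (singularCochains X R).cochains q Z →ₗ[R] R :=
  (LinearMap.proj ((TopCat.toSSetObjEquiv (TopCat.of Z) (op (SimplexCategory.mk q))).symm s) :
    ((TopCat.toSSet.obj (TopCat.of Z)).obj (op (SimplexCategory.mk q)) → R) →ₗ[R] R)

/-- The singular cochain with given values. -/
def ofValues {q : ℕ} {Z : Set X} (f : C(Splx (q + 1), Z) → R) :
    (singularCochains X R).cochains q Z :=
  (fun t => f (TopCat.toSSetObjEquiv (TopCat.of Z) (op (SimplexCategory.mk q)) t) :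
    (TopCat.toSSet.obj (TopCat.of Z)).obj (op (SimplexCategory.mk q)) → R)

lemma evalAt_ofValues {q : ℕ} {Z : Set X} (f : C(Splx (q + 1), Z) → R) (s) :
    evalAt s (ofValues f) = f s :=
  congrArg f (Equiv.apply_symm_apply _ _)

lemma cochain_ext {q : ℕ} {Z : Set X} {c c' : (singularCochains X R).cochains q Z}
    (h : ∀ s, evalAt s c = evalAt s c') : c = c' := by
  refine funext (f := (c : (TopCat.toSSet.obj (TopCat.of Z)).obj (op (SimplexCategory.mk q)) → R))
    fun t => ?_
  have := h (TopCat.toSSetObjEquiv (TopCat.of Z) (op (SimplexCategory.mk q)) t)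
  have e := Equiv.symm_apply_apply
    (TopCat.toSSetObjEquiv (TopCat.of Z) (op (SimplexCategory.mk q))) t
  change (c : (TopCat.toSSet.obj (TopCat.of Z)).obj (op (SimplexCategory.mk q)) → R) _ =
    (c' : (TopCat.toSSet.obj (TopCat.of Z)).obj (op (SimplexCategory.mk q)) → R) _ at this
  rwa [e] at this

/-- The inclusion of subspaces as a continuous map. -/
def inclMap {Y Z : Set X} (h : Y ⊆ Z) : C(Y, Z) := ⟨Set.inclusion h, continuous_inclusion h⟩

lemma evalAt_res {q : ℕ} {Y Z : Set X} (h : Y ⊆ Z) (s : C(Splx (q + 1), Y))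
    (c : (singularCochains X R).cochains q Z) :
    evalAt s ((singularCochains X R).res q h c) = evalAt ((inclMap h).comp s) c := by
  rfl

lemma δ_toSSetObjEquiv_symm {q : ℕ} {Z : Set X} (s : C(Splx (q + 2), Z)) (i : Fin (q + 2)) :
    (TopCat.toSSet.obj (TopCat.of Z)).δ i
      ((TopCat.toSSetObjEquiv (TopCat.of Z) (op (SimplexCategory.mk (q + 1)))).symm s) =
    (TopCat.toSSetObjEquiv (TopCat.of Z) (op (SimplexCategory.mk q))).symm
      (s.comp (aff (vert (q + 2) ∘ i.succAbove))) := by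
  have : aff (vert (q + 2) ∘ i.succAbove) =
      ⟨stdSimplex.map i.succAbove, stdSimplex.continuous_map _⟩ :=
    ContinuousMap.ext fun t => aff_vert_comp _ t
  rw [this]
  rfl

lemma hom_sum_zsmul_apply {M N : ModuleCat.{w} R} {ι : Type*} (s : Finset ι) (a : ι → ℤ)
    (f : ι → (M ⟶ N)) (c : M) : (∑ i ∈ s, a i • f i).hom c = ∑ i ∈ s, a i • (f i).hom c := by
  rw [ModuleCat.hom_sum, LinearMap.sum_apply]
  rfl

lemma alternatingCofaceMapComplex_d_apply (Y : CosimplicialObject (ModuleCat.{w} R)) (q : ℕ)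
    (c : Y.obj (SimplexCategory.mk q)) :
    ((AlgebraicTopology.AlternatingCofaceMapComplex.obj Y).d q (q + 1)).hom c =
      ∑ i : Fin (q + 2), (-1 : ℤ) ^ (i : ℕ) • (Y.δ i).hom c := by
  have h : (AlgebraicTopology.AlternatingCofaceMapComplex.obj Y).d q (q + 1) =
      ∑ i : Fin (q + 2), (-1 : ℤ) ^ (i : ℕ) • Y.δ i :=
    CochainComplex.of_d (fun n => Y.obj (SimplexCategory.mk n))
      (AlgebraicTopology.AlternatingCofaceMapComplex.objD Y) q
  exact (congrArg (fun f => f.hom c) h).trans (hom_sum_zsmul_apply _ _ _ c)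

lemma evalAt_diff {q : ℕ} {Z : Set X} (s : C(Splx (q + 2), Z))
    (c : (singularCochains X R).cochains q Z) :
    evalAt s ((singularCochains X R).diff q Z c) = ∑ i : Fin (q + 2),
      (-1 : ℤ) ^ (i : ℕ) • evalAt (s.comp (aff (vert (q + 2) ∘ i.succAbove))) c := by
  refine (congrArg (evalAt s) (alternatingCofaceMapComplex_d_apply
    ((TopCat.toSSet.obj (TopCat.of Z)).rightOp ⋙ functionsModule R) q c)).trans ?_
  refine (map_sum (evalAt (R := R) s) _ _).trans ?_
  refine Finset.sum_congr rfl fun i _ => ?_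
  refine (map_zsmul (evalAt (R := R) s) _ _).trans ?_
  congr 1
  exact congrArg (c : (TopCat.toSSet.obj (TopCat.of Z)).obj (op (SimplexCategory.mk q)) → R)
    (δ_toSSetObjEquiv_symm s i)

end

/-! ### Exactness of the columns of the double complex of singular cochains -/

section

variable {V : Type u} [LinearOrder V]

/-- The contraction of the simplicial cochains of a cone with apex `v`. -/
lemma eq_sum_coneHomotopy {M : Type*} [AddCommGroup M] (g : Finset V → M) (v : V) (σ : Finset V)
    (hg : v ∉ σ → ∑ x ∈ insert v σ,
      (-1 : ℤ) ^ pos (insert v σ) x • g ((insert v σ).erase x) = 0) :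
    g σ = ∑ x ∈ σ, (-1 : ℤ) ^ pos σ x • (if v ∈ σ.erase x then 0 else
      (-1 : ℤ) ^ pos (insert v (σ.erase x)) v • g (insert v (σ.erase x))) := by
  have sq (n : ℕ) : (-1 : ℤ) ^ n * (-1) ^ n = 1 := by
    rw [← mul_pow]; norm_num
  by_cases hv : v ∈ σ
  -- If `v` is a vertex of `σ`, only the face opposite to `v` contributes, and it returns `g σ`.
  · rw [Finset.sum_eq_single v]
    · rw [if_neg (Finset.notMem_erase v σ), Finset.insert_erase hv, smul_smul, sq, one_smul]
    · intro x _ hx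
      rw [if_pos (Finset.mem_erase.2 ⟨hx.symm, hv⟩), smul_zero]
    · exact fun h => (h hv).elim
  · have h := hg hv
    rw [Finset.sum_insert hv, Finset.erase_insert hv, add_eq_zero_iff_eq_neg] at h
    have h' := congrArg (fun y => (-1 : ℤ) ^ pos (insert v σ) v • y) h
    simp only [smul_smul, sq, one_smul] at h'
    rw [h', smul_neg, Finset.smul_sum, ← Finset.sum_neg_distrib]
    refine Finset.sum_congr rfl fun x hx => ?_
    have hxv : x ≠ v := fun e => hv (e ▸ hx)
    rw [if_neg fun e => hv (Finset.mem_of_mem_erase e), smul_smul, smul_smul, ← neg_smul]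
    have e1 : (insert v σ).erase x = insert v (σ.erase x) :=
      Finset.erase_insert_of_ne hxv.symm
    have key := sign_swap (Finset.mem_insert_of_mem hx) (Finset.mem_insert_self v σ) hxv
    rw [Finset.erase_insert hv, e1] at key
    rw [e1]
    congr 1
    rcases neg_one_pow_eq_or ℤ (pos (insert v σ) x) with h1 | h1 <;>
    rcases neg_one_pow_eq_or ℤ (pos (insert v σ) v) with h2 | h2 <;>
    rcases neg_one_pow_eq_or ℤ (pos σ x) with h3 | h3 <;>
    rcases neg_one_pow_eq_or ℤ (pos (insert v (σ.erase x)) v) with h4 | h4 <;>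
    rw [h1, h2, h3, h4] at key <;> rw [h1, h2, h3, h4] <;> linarith

end

section

variable {X : Type u} [TopologicalSpace X] {V : Type u} [LinearOrder V] (U : V → Set X)
  {R : Type v} [Ring R]

/-- The corestriction of a singular simplex to a subspace containing its image. -/
def corestrict {q : ℕ} (s : C(Splx q, (Set.univ : Set X))) {Z : Set X}
    (h : ∀ t, (s t).1 ∈ Z) : C(Splx q, Z) :=
  ⟨fun t => ⟨(s t).1, h t⟩, by fun_prop⟩

/-- A singular simplex of a subspace as a singular simplex of the whole space. -/
def toUniv {q : ℕ} {Z : Set X} (s : C(Splx q, Z)) : C(Splx q, (Set.univ : Set X)) :=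
  (inclMap (Set.subset_univ Z)).comp s

lemma mem_faces_of_mem_inter {σ : Finset V} (hσ : σ.Nonempty) {x : X} (hx : x ∈ inter U σ) :
    σ ∈ (nerve U).faces :=
  ⟨hσ, ⟨x, hx⟩⟩

lemma mem_inter_insert {σ : Finset V} {v : V} {x : X} (hv : x ∈ U v) (hx : x ∈ inter U σ) :
    x ∈ inter U (insert v σ) := by
  simp only [inter, Set.mem_iInter₂] at hx ⊢
  intro y hy
  rcases Finset.mem_insert.1 hy with rfl | hy
  · exact hv
  · exact hx y hy

open Classical in
/-- The value of a cochain `c` of the double complex on the simplex `σ` of the nerve and the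
singular simplex `s`, extended by zero. -/
def value {p q : ℕ} (c : nerveCochains U (singularCochains X R) p q)
    (s : C(Splx (q + 1), (Set.univ : Set X))) (σ : Finset V) : R :=
  if h : (σ ∈ (nerve U).faces ∧ σ.card = p + 1) ∧ ∀ t, (s t).1 ∈ inter U σ then
    evalAt (corestrict s h.2) (c ⟨σ, h.1⟩) else 0

variable {U}

/-- For fixed `s`, `value` turns a family of cochains on varying subspaces into a plain function of
finite sets, to which the cone formula applies. -/
lemma value_toUniv {p q : ℕ} (c : nerveCochains U (singularCochains X R) p q)
    (σ : Simp (nerve U) p) (s : C(Splx (q + 1), inter U σ.1)) :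
    value U c (toUniv s) σ.1 = evalAt s (c σ) :=
  dif_pos ⟨σ.2, fun t => (s t).2⟩

lemma value_face {p q : ℕ} (c : nerveCochains U (singularCochains X R) p q)
    (σ : Simp (nerve U) (p + 1)) (s : C(Splx (q + 1), inter U σ.1)) (x : σ.1) :
    value U c (toUniv s) (σ.1.erase x) =
      evalAt s ((singularCochains X R).res q (inter_face U σ x) (c (σ.face x))) :=
  value_toUniv c (σ.face x) ((inclMap (inter_face U σ x)).comp s)

lemma evalAt_nerveDelta {p q : ℕ} (c : nerveCochains U (singularCochains X R) p q)
    (σ : Simp (nerve U) (p + 1)) (s : C(Splx (q + 1), inter U σ.1)) :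
    evalAt s (nerveDelta U (singularCochains X R) p q c σ) =
      ∑ x ∈ σ.1, (-1 : ℤ) ^ pos σ.1 x • value U c (toUniv s) (σ.1.erase x) := by
  rw [nerveDelta_apply, map_sum,
    ← Finset.sum_coe_sort σ.1 fun x => (-1 : ℤ) ^ pos σ.1 x • value U c (toUniv s) (σ.1.erase x)]
  refine Finset.sum_congr rfl fun x _ => ?_
  rw [map_zsmul, value_face]

lemma sum_value_eq_zero {p q : ℕ} {c : nerveCochains U (singularCochains X R) p q}
    (hc : nerveDelta U (singularCochains X R) p q c = 0) {ρ : Finset V} (hρ : ρ.card = p + 2)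
    (s : C(Splx (q + 1), (Set.univ : Set X))) (hs : ∀ t, (s t).1 ∈ inter U ρ) :
    ∑ x ∈ ρ, (-1 : ℤ) ^ pos ρ x • value U c s (ρ.erase x) = 0 := by
  have h := evalAt_nerveDelta c
    -- The image of a vertex of `s` is a point of `|ρ|`, so `ρ` is a simplex of the nerve.
    ⟨ρ, mem_faces_of_mem_inter U (Finset.card_pos.1 (by omega)) (hs (vert _ 0)), hρ⟩
    (corestrict s hs)
  rw [hc] at h
  exact h.symm.trans (map_zero _)

/-- The singular simplex `s` is contained in a member of the family. -/
def IsSubordinate (U : V → Set X) {q : ℕ} (s : C(Splx q, (Set.univ : Set X))) : Prop :=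
  ∃ v, ∀ t, (s t).1 ∈ U v

/-- A cocycle is determined by its values on the simplices containing a fixed vertex. -/
lemma value_eq_sum {p q : ℕ} {c : nerveCochains U (singularCochains X R) p q}
    (hc : nerveDelta U (singularCochains X R) p q c = 0) {σ : Finset V} (hσ : σ.card = p + 1)
    (s : C(Splx (q + 1), (Set.univ : Set X))) (hs : ∀ t, (s t).1 ∈ inter U σ)
    {v : V} (hv : ∀ t, (s t).1 ∈ U v) :
    value U c s σ = ∑ x ∈ σ, (-1 : ℤ) ^ pos σ x • (if v ∈ σ.erase x then 0 else
      (-1 : ℤ) ^ pos (insert v (σ.erase x)) v • value U c s (insert v (σ.erase x))) := by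
  refine eq_sum_coneHomotopy _ v σ fun h => ?_
  exact sum_value_eq_zero hc (by rw [Finset.card_insert_of_notMem h, hσ]) s
    fun t => mem_inter_insert U (hv t) (hs t)

lemma isSubordinate_toUniv {p q : ℕ} (σ : Simp (nerve U) p)
    (s : C(Splx q, inter U σ.1)) : IsSubordinate U (toUniv s) := by
  obtain ⟨v, hv⟩ := σ.2.1.1
  exact ⟨v, fun t => Set.mem_iInter₂.1 (s t).2 v hv⟩

/-- The primitive on `σ` and `s` is, up to sign, the value of `c` on the cone over `σ` with an apex
`v` such that `U v` contains `s`. -/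
theorem nerveDelta_exact_succ {p q : ℕ} {c : nerveCochains U (singularCochains X R) (p + 1) q}
    (hc : nerveDelta U (singularCochains X R) (p + 1) q c = 0) :
    ∃ b, nerveDelta U (singularCochains X R) p q b = c := by
  classical
  -- The apex depends only on `s` as a simplex of `X`, so that all faces of `σ` use the same one.
  have H : ∀ s : {s : C(Splx (q + 1), (Set.univ : Set X)) // IsSubordinate U s},
    ∃ v, ∀ t, (s.1 t).1 ∈ U v := fun s => s.2
  choose v hv using H
  let b : nerveCochains U (singularCochains X R) p q := fun σ => ofValues fun s =>
    if v ⟨_, isSubordinate_toUniv σ s⟩ ∈ σ.1 then 0 else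
      (-1 : ℤ) ^ pos (insert (v ⟨_, isSubordinate_toUniv σ s⟩) σ.1)
        (v ⟨_, isSubordinate_toUniv σ s⟩) •
        value U c (toUniv s) (insert (v ⟨_, isSubordinate_toUniv σ s⟩) σ.1)
  refine ⟨b, funext fun σ => cochain_ext fun s => ?_⟩
  rw [evalAt_nerveDelta, ← value_toUniv, value_eq_sum hc σ.2.2 (toUniv s) (fun t => (s t).2)
    (hv ⟨_, isSubordinate_toUniv σ s⟩)]
  refine Finset.sum_congr rfl fun x hx => ?_
  congr 1
  rw [value_face b σ s ⟨x, hx⟩, evalAt_res]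
  exact evalAt_ofValues _ _

/-- The restriction of cochains on `X` to the members of the covering. -/
def restriction (U : V → Set X) (A : CochainFunctor.{u, v, max u v} X R) (n : ℕ) :
    A.cochains n Set.univ →ₗ[R] nerveCochains U A 0 n :=
  LinearMap.pi fun σ => A.res n (Set.subset_univ (inter U σ.1))

/-- The cocycle condition makes the value on `s` the same for all members containing `s`, so any
chosen member defines the glued cochain; simplices in no member get the value `0`. -/
theorem exists_restriction_eq {q : ℕ} {c : nerveCochains U (singularCochains X R) 0 q}
    (hc : nerveDelta U (singularCochains X R) 0 q c = 0) :
    ∃ a, restriction U (singularCochains X R) q a = c := by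
  classical
  let a : (singularCochains X R).cochains q Set.univ := ofValues fun s =>
    if h : IsSubordinate U s then value U c s {h.choose} else 0
  refine ⟨a, funext fun σ => cochain_ext fun s => ?_⟩
  have h := isSubordinate_toUniv σ s
  have e : evalAt s (restriction U (singularCochains X R) q a σ) =
      value U c (toUniv s) {h.choose} := by
    change evalAt (toUniv s) a = _
    rw [evalAt_ofValues, dif_pos h]
  rw [e, ← value_toUniv, value_eq_sum hc σ.2.2 (toUniv s) (fun t => (s t).2) h.choose_spec]
  obtain ⟨x, hx⟩ := Finset.card_eq_one.1 σ.2.2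
  have hp (y : V) : pos {y} y = 0 := by simp [pos, Finset.filter_singleton]
  generalize value U c (toUniv s) = g
  have key (τ : Finset V) (v : V) (hτ : τ = {x}) : g {v} = ∑ x ∈ τ, (-1 : ℤ) ^ pos τ x •
      (if v ∈ τ.erase x then 0 else
        (-1 : ℤ) ^ pos (insert v (τ.erase x)) v • g (insert v (τ.erase x))) := by
    subst hτ
    simp [hp]
  exact key _ _ hx

/-! ### Acyclicity of the kernel of restriction to the covering -/

lemma evalAt_eq_zero_of_restriction_eq_zero {q : ℕ}
    {a : (singularCochains X R).cochains q Set.univ}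
    (ha : restriction U (singularCochains X R) q a = 0)
    {s : C(Splx (q + 1), (Set.univ : Set X))} (hs : IsSubordinate U s) : evalAt s a = 0 := by
  obtain ⟨v, hv⟩ := hs
  have hv' : ∀ t, (s t).1 ∈ inter U {v} := fun t => by simpa [inter] using hv t
  let σ : Simp (nerve U) 0 := ⟨{v}, mem_faces_of_mem_inter U (Finset.singleton_nonempty v)
    (hv' (vert _ 0)), Finset.card_singleton v⟩
  exact (congrArg (evalAt (corestrict s hv')) (congrFun ha σ)).trans (map_zero _)

lemma exists_relative_values (hU : ⋃ i, interior (U i) = Set.univ) {q : ℕ}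
    {a : (singularCochains X R).cochains q Set.univ}
    (ha : restriction U (singularCochains X R) q a = 0)
    (hda : (singularCochains X R).diff q Set.univ a = 0) :
    ∃ b : C(Splx q, (Set.univ : Set X)) → R,
      (∀ s, SingChain.IsSmall (fun v => (Subtype.val ⁻¹' U v : Set (Set.univ : Set X))) s →
        b s = 0) ∧
      ∀ s : C(Splx (q + 1), (Set.univ : Set X)), evalAt s a = ∑ i : Fin (q + 1),
        (-1 : ℤ) ^ (i : ℕ) • b (s.comp (aff (vert (q + 1) ∘ i.succAbove))) := by
  refine SingChain.exists_relative_primitive ?_ (fun s => evalAt s a) (fun s hs => ?_) fun s => ?_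
  · rw [Set.eq_univ_iff_forall]
    intro x
    obtain ⟨i, hi⟩ := Set.mem_iUnion.1 (Set.eq_univ_iff_forall.1 hU x.1)
    exact Set.mem_iUnion.2
      ⟨i, preimage_interior_subset_interior_preimage continuous_subtype_val hi⟩
  · obtain ⟨v, hv⟩ := hs.resolve_left (Nat.succ_ne_zero q)
    exact evalAt_eq_zero_of_restriction_eq_zero ha ⟨v, fun t => hv ⟨t, rfl⟩⟩
  · exact (evalAt_diff s a).symm.trans ((congrArg (evalAt s) hda).trans (map_zero _))

theorem restriction_zero_injective (hU : ⋃ i, interior (U i) = Set.univ)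
    {a : (singularCochains X R).cochains 0 Set.univ}
    (ha : restriction U (singularCochains X R) 0 a = 0)
    (hda : (singularCochains X R).diff 0 Set.univ a = 0) : a = 0 := by
  obtain ⟨b, hb, hab⟩ := exists_relative_values hU ha hda
  refine cochain_ext fun s => ?_
  rw [hab, map_zero]
  -- In degree zero the primitive lives on the empty simplex, which counts as small.
  exact Finset.sum_eq_zero fun i _ => by rw [hb _ (Or.inl rfl), smul_zero]

theorem exists_restriction_eq_zero_diff_eq (hU : ⋃ i, interior (U i) = Set.univ) {q : ℕ}
    {a : (singularCochains X R).cochains (q + 1) Set.univ}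
    (ha : restriction U (singularCochains X R) (q + 1) a = 0)
    (hda : (singularCochains X R).diff (q + 1) Set.univ a = 0) :
    ∃ b, restriction U (singularCochains X R) q b = 0 ∧
      (singularCochains X R).diff q Set.univ b = a := by
  obtain ⟨b, hb, hab⟩ := exists_relative_values hU ha hda
  refine ⟨ofValues b, funext fun σ => cochain_ext fun s => ?_, cochain_ext fun s => ?_⟩
  · refine ((evalAt_ofValues b (toUniv s)).trans (hb _ (Or.inr ?_))).trans (map_zero _).symm
    obtain ⟨v, hv⟩ := isSubordinate_toUniv σ s
    exact ⟨v, by rintro _ ⟨t, rfl⟩; exact hv t⟩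
  · rw [evalAt_diff, hab]
    exact Finset.sum_congr rfl fun i _ => by rw [evalAt_ofValues]

end

/-! ### Quasi-isomorphisms of complexes of modules -/

section

variable {R : Type v} [Ring R]

lemma homologyπ_eq_zero_iff (S : ShortComplex (ModuleCat.{w} R)) (z : S.cycles) :
    S.homologyπ z = 0 ↔ ∃ y, S.f y = S.iCycles z := by
  have h : S.homologyι (S.homologyπ z) = S.pOpcycles (S.iCycles z) := by
    rw [← ModuleCat.comp_apply, ← ModuleCat.comp_apply, S.homology_π_ι]
  have h2 := S.moduleCat_pOpcycles_eq_zero_iff (S.iCycles z)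
  rw [← h] at h2
  have hinj := (ModuleCat.mono_iff_injective S.homologyι).1 inferInstance
  rw [← map_eq_zero_iff _ hinj, h2]
  rfl

lemma exists_iCycles_eq (S : ShortComplex (ModuleCat.{w} R)) {x : S.X₂} (hx : S.g x = 0) :
    ∃ z : S.cycles, S.iCycles z = x :=
  ⟨S.moduleCatCyclesIso.inv ⟨x, hx⟩, S.moduleCatCyclesIso_inv_iCycles_apply _⟩

lemma isIso_homologyMap_of_elements {S₁ S₂ : ShortComplex (ModuleCat.{w} R)} (φ : S₁ ⟶ S₂)
    (hinj : ∀ b : S₁.X₂, S₁.g b = 0 → (∃ y, S₂.f y = φ.τ₂ b) → ∃ b', S₁.f b' = b)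
    (hsurj : ∀ x : S₂.X₂, S₂.g x = 0 → ∃ b, S₁.g b = 0 ∧ ∃ y, x = S₂.f y + φ.τ₂ b) :
    IsIso (ShortComplex.homologyMap φ) := by
  have hπ (S : ShortComplex (ModuleCat.{w} R)) : Function.Surjective S.homologyπ :=
    (ModuleCat.epi_iff_surjective _).1 inferInstance
  have hnat (z : S₁.cycles) : ShortComplex.homologyMap φ (S₁.homologyπ z) =
      S₂.homologyπ (ShortComplex.cyclesMap φ z) := by
    rw [← ModuleCat.comp_apply, ← ModuleCat.comp_apply, ShortComplex.homologyπ_naturality]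
  have hi (z : S₁.cycles) : S₂.iCycles (ShortComplex.cyclesMap φ z) = φ.τ₂ (S₁.iCycles z) := by
    rw [← ModuleCat.comp_apply, ← ModuleCat.comp_apply, ShortComplex.cyclesMap_i]
  have hg (S : ShortComplex (ModuleCat.{w} R)) (z : S.cycles) : S.g (S.iCycles z) = 0 := by
    rw [← ModuleCat.comp_apply, S.iCycles_g]; rfl
  have : Mono (ShortComplex.homologyMap φ) := by
    rw [ModuleCat.mono_iff_injective, injective_iff_map_eq_zero]
    intro γ hγ
    obtain ⟨z, rfl⟩ := hπ S₁ γ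
    rw [hnat, homologyπ_eq_zero_iff, hi] at hγ
    exact (homologyπ_eq_zero_iff _ _).2 (hinj _ (hg _ _) hγ)
  have : Epi (ShortComplex.homologyMap φ) := by
    rw [ModuleCat.epi_iff_surjective]
    intro γ
    obtain ⟨z, rfl⟩ := hπ S₂ γ
    obtain ⟨b, hb, y, hy⟩ := hsurj _ (hg _ z)
    obtain ⟨z', rfl⟩ := exists_iCycles_eq S₁ hb
    refine ⟨S₁.homologyπ z', ?_⟩
    rw [hnat, ← sub_eq_zero, ← map_sub, homologyπ_eq_zero_iff]
    refine ⟨-y, ?_⟩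
    rw [map_sub, hi, hy, map_neg]
    abel
  exact isIso_of_mono_of_epi _

lemma isIso_homologyMap_zero {K L : CochainComplex (ModuleCat.{w} R) ℕ} (f : K ⟶ L)
    (hinj : ∀ b : K.X 0, K.d 0 1 b = 0 → f.f 0 b = 0 → b = 0)
    (hsurj : ∀ x : L.X 0, L.d 0 1 x = 0 → ∃ b, K.d 0 1 b = 0 ∧ x = f.f 0 b) :
    IsIso (HomologicalComplex.homologyMap f 0) := by
  rw [← quasiIsoAt_iff_isIso_homologyMap, quasiIsoAt_iff' f 0 0 1 (by simp) (by simp),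
    ShortComplex.quasiIso_iff]
  -- The predecessor of degree `0` is `0` by convention, so the incoming map is `d 0 0`, which
  -- vanishes.
  have hd (M : CochainComplex (ModuleCat.{w} R) ℕ) (y : M.X 0) : M.d 0 0 y = 0 := by
    rw [M.shape 0 0 (by simp)]; rfl
  refine isIso_homologyMap_of_elements _ ?_ ?_
  · rintro b hb ⟨y, hy⟩
    exact ⟨0, (map_zero _).trans (hinj b hb (hy.symm.trans (hd L y))).symm⟩
  · intro x hx
    obtain ⟨b, hb, e⟩ := hsurj x hx
    exact ⟨b, hb, 0, e.trans ((congrArg (· + f.f 0 b) (map_zero (L.d 0 0).hom)).trans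
      (zero_add _)).symm⟩

lemma isIso_homologyMap_succ {K L : CochainComplex (ModuleCat.{w} R) ℕ} (f : K ⟶ L) (n : ℕ)
    (hinj : ∀ b : K.X (n + 1), K.d (n + 1) (n + 2) b = 0 →
      (∃ y, L.d n (n + 1) y = f.f (n + 1) b) → ∃ b', K.d n (n + 1) b' = b)
    (hsurj : ∀ x : L.X (n + 1), L.d (n + 1) (n + 2) x = 0 →
      ∃ b, K.d (n + 1) (n + 2) b = 0 ∧ ∃ y, x = L.d n (n + 1) y + f.f (n + 1) b) :
    IsIso (HomologicalComplex.homologyMap f (n + 1)) := by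
  rw [← quasiIsoAt_iff_isIso_homologyMap,
    quasiIsoAt_iff' f n (n + 1) (n + 2) (by simp) (by simp), ShortComplex.quasiIso_iff]
  exact isIso_homologyMap_of_elements _ hinj hsurj

end

/-! ### The edge homomorphism of a double complex with exact columns -/

namespace DoubleComplex

variable {R : Type v} [Ring R] (K : DoubleComplex.{v, w} R)

lemma incl_self {p q n : ℕ} (h : p + q = n) (c : K.X p q) : K.incl p q h c ⟨(p, q), h⟩ = c :=
  Pi.single_eq_same _ _

lemma incl_of_ne {p q n a b : ℕ} (h : p + q = n) (h' : a + b = n) (hne : a ≠ p) (c : K.X p q) :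
    K.incl p q h c ⟨(a, b), h'⟩ = 0 :=
  Pi.single_eq_of_ne (fun e => hne (by simpa using congrArg (fun x => x.1.1) e)) _

lemma total_d (n : ℕ) : K.total.d n (n + 1) = ModuleCat.ofHom (K.D n) :=
  CochainComplex.of_d (fun n => ModuleCat.of R (K.T n)) (fun n => ModuleCat.ofHom (K.D n)) n

lemma incl_eq_zero_iff {p q n : ℕ} (h : p + q = n) (c : K.X p q) :
    K.incl p q h c = 0 ↔ c = 0 := by
  refine ⟨fun e => ?_, fun e => by rw [e, map_zero]⟩
  have := congrFun e ⟨(p, q), h⟩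
  rwa [incl_self] at this

/-- The elements of the total complex whose components in `K^{a,b}` vanish for `a > k`. -/
def Below (k : ℕ) {n : ℕ} (x : K.T n) : Prop :=
  ∀ (a b : ℕ) (h : a + b = n), k < a → x ⟨(a, b), h⟩ = 0

variable {K}

lemma eq_incl_of_below {n : ℕ} {x : K.T n} (hx : K.Below 0 x) :
    x = K.incl 0 n (zero_add n) (x ⟨(0, n), zero_add n⟩) := by
  funext ⟨⟨a, b⟩, h⟩
  rcases a with _ | a
  · obtain rfl : b = n := by simpa using h
    exact (K.incl_self _ _).symm
  · rw [hx _ _ _ (Nat.succ_pos a)]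
    exact (K.incl_of_ne _ _ (Nat.succ_ne_zero a) _).symm

lemma below_incl {n : ℕ} (c : K.X 0 n) : K.Below 0 (K.incl 0 n (zero_add n) c) :=
  fun _ _ _ ha => K.incl_of_ne _ _ ha.ne' _

lemma below_zero {k n : ℕ} : K.Below k (0 : K.T n) := fun _ _ _ _ => rfl

/-- The `(k + 1, q)` component of `D x` is this `δ` plus a term coming from a component of `x`
beyond `k`, which vanishes. -/
lemma δ_eq_zero_of_below {k q n : ℕ} (h : k + q = n) {x : K.T n} (hx : K.Below k x)
    (hDx : K.Below 0 (K.D n x)) : K.δ k q (x ⟨(k, q), h⟩) = 0 := by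
  have h1 := hDx (k + 1) q (by omega) (Nat.succ_pos k)
  rcases q with _ | q
  · exact (add_zero _).symm.trans h1
  · have h2 : K.horizontal n ⟨(k + 1, q + 1), by dsimp only; omega⟩ x = 0 := by
      change ((-1 : ℤ) ^ (k + 1)) • K.d (k + 1) q (x ⟨(k + 1, q), _⟩) = 0
      rw [hx _ _ _ (Nat.lt_succ_self k), map_zero, smul_zero]
    have h3 : K.δ k (q + 1) (x ⟨(k, q + 1), h⟩) +
      K.horizontal n ⟨(k + 1, q + 1), by dsimp only; omega⟩ x = 0 := h1
    rwa [h2, add_zero] at h3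

variable (hK : ∀ p q (c : K.X (p + 1) q), K.δ (p + 1) q c = 0 → ∃ b, K.δ p q b = c)
include hK

/-- The top component is `δ`-closed, hence `δ b`. Subtracting `D b` removes it and otherwise changes
only the component with first index `k`. -/
lemma exists_below_of_below_succ {k n : ℕ} {x : K.T (n + 1)} (hx : K.Below (k + 1) x)
    (hDx : K.Below 0 (K.D (n + 1) x)) : ∃ y : K.T n, K.Below k (x - K.D n y) := by
  by_cases hkn : k ≤ n
  · obtain ⟨q, rfl⟩ := Nat.exists_eq_add_of_le hkn
    obtain ⟨b, hb⟩ := hK k q _ (δ_eq_zero_of_below (by omega : k + 1 + q = k + q + 1) hx hDx)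
    refine ⟨K.incl k q rfl b, fun a c h ha => ?_⟩
    rw [D_incl]
    change x ⟨(a, c), h⟩ - (K.incl (k + 1) q _ (K.δ k q b) ⟨(a, c), h⟩ +
      ((-1 : ℤ) ^ k) • K.incl k (q + 1) _ (K.d k q b) ⟨(a, c), h⟩) = 0
    rw [K.incl_of_ne (p := k) _ _ (by omega), smul_zero, add_zero, sub_eq_zero]
    by_cases hak : a = k + 1
    · subst hak
      obtain rfl : c = q := by omega
      rw [incl_self, hb]
    · rw [K.incl_of_ne _ _ hak, hx _ _ _ (by omega)]
  · exact ⟨0, fun a c h ha => by omega⟩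

lemma exists_below {n : ℕ} {x : K.T (n + 1)} (hDx : K.Below 0 (K.D (n + 1) x)) :
    ∃ y : K.T n, K.Below 0 (x - K.D n y) := by
  suffices ∀ (k : ℕ) (x : K.T (n + 1)), K.Below k x → K.Below 0 (K.D (n + 1) x) →
      ∃ y : K.T n, K.Below 0 (x - K.D n y) from
    this (n + 1) x (fun a b h ha => by omega) hDx
  intro k
  induction k with
  | zero => exact fun x hx _ => ⟨0, by rwa [map_zero, sub_zero]⟩
  | succ k ih =>
    intro x hx hDx
    obtain ⟨y, hy⟩ := exists_below_of_below_succ hK hx hDx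
    obtain ⟨y', hy'⟩ := ih _ hy (by rwa [map_sub, D_D, sub_zero])
    exact ⟨y + y', by rwa [map_add, ← sub_sub]⟩

omit hK

section Edge

variable {B : ℕ → Type w} [∀ n, AddCommGroup (B n)] [∀ n, Module R (B n)]

/-- The data of an edge homomorphism from a complex `B` to the total complex, such that `B` maps
onto the kernel of the first differential of the columns and the kernel of `B → K^{0,•}` is
acyclic. -/
structure Edge (K : DoubleComplex.{v, w} R) (d : ∀ n, B n →ₗ[R] B (n + 1))
    (ε : ∀ n, B n →ₗ[R] K.X 0 n) : Prop where
  d_d : ∀ n b, d (n + 1) (d n b) = 0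
  comm : ∀ n b, K.D n (K.incl 0 n (zero_add n) (ε n b)) =
    K.incl 0 (n + 1) (zero_add (n + 1)) (ε (n + 1) (d n b))
  surj : ∀ n (c : K.X 0 n), K.δ 0 n c = 0 → ∃ b, ε n b = c
  zero : ∀ b, ε 0 b = 0 → d 0 b = 0 → b = 0
  succ : ∀ n b, ε (n + 1) b = 0 → d (n + 1) b = 0 → ∃ b', ε n b' = 0 ∧ d n b' = b

namespace Edge

variable {d : ∀ n, B n →ₗ[R] B (n + 1)} {ε : ∀ n, B n →ₗ[R] K.X 0 n} (h : Edge K d ε)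
include h

lemma exists_incl_eq {n : ℕ} {x : K.T n} (hx : K.Below 0 x) (hDx : K.Below 0 (K.D n x)) :
    ∃ b, K.incl 0 n (zero_add n) (ε n b) = x := by
  obtain ⟨b, hb⟩ := h.surj n _ (δ_eq_zero_of_below (zero_add n) hx hDx)
  exact ⟨b, by rw [hb, ← eq_incl_of_below hx]⟩

/-- Here `d b` is a cocycle in the acyclic kernel of `ε`, so `b` can be corrected by an element of
that kernel. -/
lemma exists_cocycle {n : ℕ} {b : B n} (hb : K.D n (K.incl 0 n (zero_add n) (ε n b)) = 0) :
    ∃ b', d n b' = 0 ∧ ε n b' = ε n b := by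
  rw [h.comm, K.incl_eq_zero_iff] at hb
  obtain ⟨b', h1, h2⟩ := h.succ n _ hb (h.d_d n b)
  exact ⟨b - b', by rw [map_sub, h2, sub_self], by rw [map_sub, h1, sub_zero]⟩

lemma eq_zero_of_incl_eq_zero {b : B 0} (hb : d 0 b = 0)
    (h0 : K.incl 0 0 (zero_add 0) (ε 0 b) = 0) : b = 0 :=
  h.zero b ((K.incl_eq_zero_iff _ _).1 h0) hb

lemma exists_cocycle_eq_zero {x : K.T 0} (hx : K.D 0 x = 0) :
    ∃ b, d 0 b = 0 ∧ x = K.incl 0 0 (zero_add 0) (ε 0 b) := by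
  obtain ⟨b, hb⟩ := h.exists_incl_eq (x := x) (fun a c h ha => by omega)
    (by rw [hx]; exact below_zero)
  obtain ⟨b', h1, h2⟩ := h.exists_cocycle (b := b) (by rw [hb, hx])
  exact ⟨b', h1, by rw [h2, hb]⟩

include hK

/-- Injectivity in cohomology: move `y` into `K^{0,n}` and lift it to `b₁`; then `d b₁ - b` is a
cocycle in the acyclic kernel of `ε`. -/
lemma exists_d_eq {n : ℕ} {b : B (n + 1)} (hb : d (n + 1) b = 0) {y : K.T n}
    (hy : K.D n y = K.incl 0 (n + 1) (zero_add (n + 1)) (ε (n + 1) b)) : ∃ b', d n b' = b := by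
  obtain ⟨y₀, hy₀, hy₁⟩ : ∃ y₀ : K.T n, K.Below 0 y₀ ∧
      K.D n y₀ = K.incl 0 (n + 1) (zero_add (n + 1)) (ε (n + 1) b) := by
    rcases n with _ | n
    -- In total degree `0` the only component is `K^{0,0}`.
    · exact ⟨y, fun a c h ha => by omega, hy⟩
    · obtain ⟨z, hz⟩ := exists_below hK (x := y) (by rw [hy]; exact below_incl _)
      exact ⟨_, hz, by rw [map_sub, D_D, sub_zero, hy]⟩
  obtain ⟨b₁, rfl⟩ := h.exists_incl_eq hy₀ (by rw [hy₁]; exact below_incl _)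
  rw [h.comm, ← sub_eq_zero, ← map_sub, ← map_sub, K.incl_eq_zero_iff] at hy₁
  obtain ⟨b₂, -, h2⟩ := h.succ n _ hy₁ (by rw [map_sub, h.d_d, hb, sub_zero])
  exact ⟨b₁ - b₂, by rw [map_sub, h2, sub_sub_cancel]⟩

lemma exists_cocycle_eq_succ {n : ℕ} {x : K.T (n + 1)} (hx : K.D (n + 1) x = 0) :
    ∃ b, d (n + 1) b = 0 ∧
      ∃ y, x = K.D n y + K.incl 0 (n + 1) (zero_add (n + 1)) (ε (n + 1) b) := by
  obtain ⟨y, hy⟩ := exists_below hK (x := x) (by rw [hx]; exact below_zero)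
  obtain ⟨b, hb⟩ := h.exists_incl_eq hy (by rw [map_sub, D_D, sub_zero, hx]; exact below_zero)
  obtain ⟨b', h1, h2⟩ := h.exists_cocycle (b := b) (by rw [hb, map_sub, D_D, sub_zero, hx])
  exact ⟨b', h1, y, by rw [h2, hb, add_sub_cancel]⟩

end Edge

end Edge

include hK in
/-- If the columns of a double complex are exact, an edge homomorphism is a quasi-isomorphism. -/
theorem isIso_homologyMap_edge {B : CochainComplex (ModuleCat.{w} R) ℕ} (f : B ⟶ K.total)
    {ε : ∀ n, B.X n →ₗ[R] K.X 0 n}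
    (hf : ∀ n, (f.f n).hom = K.incl 0 n (zero_add n) ∘ₗ ε n)
    (hsurj : ∀ n (c : K.X 0 n), K.δ 0 n c = 0 → ∃ b, ε n b = c)
    (hzero : ∀ b, ε 0 b = 0 → (B.d 0 1).hom b = 0 → b = 0)
    (hsucc : ∀ n b, ε (n + 1) b = 0 → (B.d (n + 1) (n + 2)).hom b = 0 →
      ∃ b', ε n b' = 0 ∧ (B.d n (n + 1)).hom b' = b) (n : ℕ) :
    IsIso (HomologicalComplex.homologyMap f n) := by
  have hD (n : ℕ) (x : K.T n) : (K.total.d n (n + 1)).hom x = K.D n x :=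
    congrArg (fun g => g.hom x) (K.total_d n)
  have hf' (n : ℕ) (b : B.X n) : (f.f n).hom b = K.incl 0 n (zero_add n) (ε n b) :=
    LinearMap.congr_fun (hf n) b
  have h : Edge K (fun n => (B.d n (n + 1)).hom) ε :=
    { d_d := fun n b => congrArg (fun g => g.hom b) (B.d_comp_d n (n + 1) (n + 2))
      comm := fun n b => by
        refine Eq.trans ?_ (hf' (n + 1) _)
        refine ((congrArg (K.D n) (hf' n b).symm).trans (hD n _).symm).trans ?_
        exact congrArg (fun g => g.hom b) (f.comm n (n + 1))
      surj := hsurj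
      zero := hzero
      succ := hsucc }
  rcases n with _ | n
  · refine isIso_homologyMap_zero f (fun b hb hb' => ?_) fun x hx => ?_
    · exact h.eq_zero_of_incl_eq_zero hb ((hf' 0 b).symm.trans hb')
    · obtain ⟨b, hb, e⟩ := h.exists_cocycle_eq_zero ((hD 0 x).symm.trans hx)
      exact ⟨b, hb, e.trans (hf' 0 b).symm⟩
  · refine isIso_homologyMap_succ f n ?_ fun x hx => ?_
    · rintro b hb ⟨y, hy⟩
      exact h.exists_d_eq hK hb ((hD n y).symm.trans (hy.trans (hf' (n + 1) b)))
    · obtain ⟨b, hb, y, e⟩ := h.exists_cocycle_eq_succ hK ((hD (n + 1) x).symm.trans hx)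
      exact ⟨b, hb, y, e.trans (congrArg₂ (· + ·) (hD n y).symm (hf' (n + 1) b).symm)⟩

end DoubleComplex

namespace DoubleComplex

variable {R : Type v} [Ring R] (K L : DoubleComplex.{v, w} R)

/-! ### Transposition and functoriality of double complexes -/

/-- The transposed double complex. -/
abbrev transpose : DoubleComplex.{v, w} R where
  X p q := K.X q p
  d p q := K.δ q p
  δ p q := K.d q p
  d_d p q := K.δ_δ q p
  δ_δ p q := K.d_d q p
  d_δ p q c := (K.d_δ q p c).symm

/-- The isomorphism of the total complex with that of the transpose, in degree `n`. -/
def transposeEquiv (n : ℕ) : K.T n ≃ₗ[R] K.transpose.T n where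
  toFun x := fun a => ((-1 : ℤ) ^ (a.1.1 * a.1.2)) • x ⟨(a.1.2, a.1.1), (add_comm _ _).trans a.2⟩
  map_add' x y := funext fun a => smul_add _ _ _
  map_smul' r x := funext fun a => smul_comm _ _ _
  invFun x := fun a => ((-1 : ℤ) ^ (a.1.1 * a.1.2)) • x ⟨(a.1.2, a.1.1), (add_comm _ _).trans a.2⟩
  left_inv x := funext fun a => by
    dsimp only
    rw [smul_smul, mul_comm a.1.2, ← mul_pow]
    norm_num
  right_inv x := funext fun a => by
    dsimp only
    rw [smul_smul, mul_comm a.1.2, ← mul_pow]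
    norm_num

lemma transposeEquiv_apply (n : ℕ) (x : K.T n) (a b : ℕ) (h : a + b = n) :
    K.transposeEquiv n x ⟨(a, b), h⟩ =
      ((-1 : ℤ) ^ (a * b)) • x ⟨(b, a), (add_comm _ _).trans h⟩ := rfl

lemma vertical_succ {n p q : ℕ} (h : p + 1 + q = n + 1) (x : K.T n) :
    K.vertical n ⟨(p + 1, q), h⟩ x = K.δ p q (x ⟨(p, q), by omega⟩) := rfl

lemma horizontal_succ {n p q : ℕ} (h : p + (q + 1) = n + 1) (x : K.T n) :
    K.horizontal n ⟨(p, q + 1), h⟩ x = ((-1 : ℤ) ^ p) • K.d p q (x ⟨(p, q), by omega⟩) := rfl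

lemma vertical_zero {n q : ℕ} (h : 0 + q = n + 1) (x : K.T n) :
    K.vertical n ⟨(0, q), h⟩ x = 0 := rfl

lemma horizontal_zero {n p : ℕ} (h : p + 0 = n + 1) (x : K.T n) :
    K.horizontal n ⟨(p, 0), h⟩ x = 0 := rfl

lemma D_apply (n : ℕ) (x : K.T n) (a : {x : ℕ × ℕ // x.1 + x.2 = n + 1}) :
    K.D n x a = K.vertical n a x + K.horizontal n a x := rfl

/-- Only `d` carries a sign in `D`, so transposition would move the sign to the other differential;
the factor `(-1)^(ab)` compensates. -/
lemma D_transposeEquiv (n : ℕ) (x : K.T n) :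
    K.transpose.D n (K.transposeEquiv n x) = K.transposeEquiv (n + 1) (K.D n x) := by
  funext ⟨⟨a, b⟩, h⟩
  rw [transposeEquiv_apply, D_apply, D_apply, add_comm (K.transpose.vertical _ _ _), smul_add]
  congr 1
  · rcases b with _ | b
    · rw [horizontal_zero, vertical_zero, smul_zero]
    · rw [horizontal_succ, vertical_succ, transposeEquiv_apply]
      refine (congrArg _ (map_zsmul (K.δ b a) _ _)).trans ?_
      rw [smul_smul, ← pow_add, mul_add, mul_one, add_comm a]
  · rcases a with _ | a
    · rw [horizontal_zero, vertical_zero, smul_zero]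
    · rw [horizontal_succ, vertical_succ, transposeEquiv_apply]
      refine (map_zsmul (K.d b a) _ _).trans ?_
      have e : (-1 : ℤ) ^ ((a + 1) * b + b) = (-1) ^ (a * b) := by
        rw [add_mul, one_mul, add_assoc, ← two_mul, pow_add, pow_mul _ 2 b, neg_one_sq, one_pow, mul_one]
      rw [smul_smul, ← pow_add, e]

/-- The total complex is isomorphic to that of the transpose. -/
def totalTransposeIso : K.total ≅ K.transpose.total :=
  HomologicalComplex.Hom.isoOfComponents (fun n => (K.transposeEquiv n).toModuleIso) (by
    rintro n _ rfl
    rw [total_d, total_d]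
    exact ModuleCat.hom_ext (LinearMap.ext fun x => K.D_transposeEquiv n x))

lemma transposeEquiv_incl (n : ℕ) (c : K.X n 0) :
    K.transposeEquiv n (K.incl n 0 rfl c) = K.transpose.incl 0 n (zero_add n) c := by
  funext ⟨⟨a, b⟩, h⟩
  rw [transposeEquiv_apply]
  rcases a with _ | a
  · obtain rfl : b = n := by simpa using h
    rw [incl_self, incl_self, zero_mul, pow_zero, one_smul]
  · rw [incl_of_ne _ _ _ (by omega), incl_of_ne _ _ _ (by omega), smul_zero]

variable {K L}

/-- The map of total complexes in degree `n` induced by a family of maps. -/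
def totalMapAux (F : ∀ p q, K.X p q →ₗ[R] L.X p q) (n : ℕ) : K.T n →ₗ[R] L.T n :=
  LinearMap.pi fun a => F a.1.1 a.1.2 ∘ₗ LinearMap.proj a

lemma totalMapAux_incl (F : ∀ p q, K.X p q →ₗ[R] L.X p q) {p q n : ℕ} (h : p + q = n)
    (c : K.X p q) : totalMapAux F n (K.incl p q h c) = L.incl p q h (F p q c) := by
  funext ⟨⟨a, b⟩, h'⟩
  change F a b (K.incl p q h c ⟨(a, b), h'⟩) = _
  by_cases e : a = p
  · subst e
    obtain rfl : b = q := by omega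
    rw [incl_self, incl_self]
  · rw [incl_of_ne _ _ _ e, incl_of_ne _ _ _ e, map_zero]

lemma D_totalMapAux (F : ∀ p q, K.X p q →ₗ[R] L.X p q)
    (hd : ∀ p q c, L.d p q (F p q c) = F p (q + 1) (K.d p q c))
    (hδ : ∀ p q c, L.δ p q (F p q c) = F (p + 1) q (K.δ p q c)) (n : ℕ) (x : K.T n) :
    L.D n (totalMapAux F n x) = totalMapAux F (n + 1) (K.D n x) := by
  funext ⟨⟨a, b⟩, h⟩
  change L.vertical n ⟨(a, b), h⟩ (totalMapAux F n x) +
    L.horizontal n ⟨(a, b), h⟩ (totalMapAux F n x) =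
    F a b (K.vertical n ⟨(a, b), h⟩ x + K.horizontal n ⟨(a, b), h⟩ x)
  rw [map_add]
  congr 1
  · rcases a with _ | a
    · exact (map_zero _).symm
    · exact hδ a b _
  · rcases b with _ | b
    · exact (map_zero _).symm
    · rw [horizontal_succ, horizontal_succ, map_zsmul]
      exact congrArg _ (hd a b _)

/-- The map of total complexes induced by a morphism of double complexes. -/
def totalMap (F : ∀ p q, K.X p q →ₗ[R] L.X p q)
    (hd : ∀ p q c, L.d p q (F p q c) = F p (q + 1) (K.d p q c))
    (hδ : ∀ p q c, L.δ p q (F p q c) = F (p + 1) q (K.δ p q c)) : K.total ⟶ L.total where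
  f n := ModuleCat.ofHom (totalMapAux F n)
  comm' := by
    rintro n _ rfl
    rw [total_d, total_d]
    exact ModuleCat.hom_ext (LinearMap.ext fun x => D_totalMapAux F hd hδ n x)

end DoubleComplex

section Covering

open HomologicalComplex

variable {X : Type u} {V : Type u} [LinearOrder V] (U : V → Set X) {R : Type v} [Ring R]

/-! ### The comparison of the nerve with the total complex -/

section

variable (A : CochainFunctor.{u, v, max u v} X R)

/-- The map `C^n(N) → C^n(N, A⁰)` induced by the augmentation. -/
def augMap (n : ℕ) : (Simp (nerve U) n → R) →ₗ[R] nerveCochains U A n 0 :=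
  LinearMap.pi fun σ => A.aug (inter U σ.1) ∘ₗ LinearMap.proj σ

variable {U A}

lemma exists_nerveD_eq (hA : IsAcyclic U A) {p q : ℕ} {c : nerveCochains U A p (q + 1)}
    (hc : nerveD U A p (q + 1) c = 0) : ∃ b, nerveD U A p q b = c := by
  have H (σ : Simp (nerve U) p) : ∃ b, A.diff q (inter U σ.1) b = c σ :=
    ((hA σ.1 σ.2.1).exact_succ q (c σ)).1 (congrFun hc σ)
  choose b hb using H
  exact ⟨b, funext hb⟩

lemma exists_augMap_eq (hA : IsAcyclic U A) {p : ℕ} {c : nerveCochains U A p 0}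
    (hc : nerveD U A p 0 c = 0) : ∃ b, augMap U A p b = c := by
  have H (σ : Simp (nerve U) p) : ∃ b, A.aug (inter U σ.1) b = c σ :=
    ((hA σ.1 σ.2.1).exact_zero (c σ)).1 (congrFun hc σ)
  choose b hb using H
  exact ⟨b, funext hb⟩

lemma augMap_eq_zero (hA : IsAcyclic U A) {p : ℕ} {c : Simp (nerve U) p → R}
    (hc : augMap U A p c = 0) : c = 0 :=
  funext fun σ => (hA σ.1 σ.2.1).aug_injective ((congrFun hc σ).trans (map_zero _).symm)

/-- After transposition `λ` is an edge homomorphism whose `ε` is the augmentation. Exactness of the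
augmented complexes gives all the hypotheses; the kernel of `ε` is even zero. -/
theorem isIso_homologyMap_lambda (hA : IsAcyclic U A) (n : ℕ) :
    IsIso (homologyMap (lambda U A) n) := by
  let K := nerveDoubleComplex U A
  have h : IsIso (homologyMap (lambda U A ≫ K.totalTransposeIso.hom) n) := by
    refine DoubleComplex.isIso_homologyMap_edge (K := K.transpose)
      (fun p q c hc => exists_nerveD_eq hA hc) (lambda U A ≫ K.totalTransposeIso.hom)
      (ε := fun n => augMap U A n) (fun n => ?_) (fun n c hc => exists_augMap_eq hA hc)
      (fun b hb _ => augMap_eq_zero hA hb)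
      (fun n b hb _ => ⟨0, map_zero _, (map_zero _).trans (augMap_eq_zero hA hb).symm⟩) n
    exact LinearMap.ext fun b => K.transposeEquiv_incl n (augMap U A n b)
  rw [homologyMap_comp] at h
  exact IsIso.of_isIso_comp_right _ (homologyMap K.totalTransposeIso.hom n)

end

/-! ### Functoriality of the total complex in the cochain functor -/

section

variable {A B : CochainFunctor.{u, v, max u v} X R} (φ : CochainFunctor.Hom A B)

/-- The component of a natural transformation of cochain functors. -/
def CochainFunctor.Hom.app (q : ℕ) (Z : Set X) : A.cochains q Z →ₗ[R] B.cochains q Z :=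
  ((φ.natTrans.app (op Z)).f q).hom

lemma CochainFunctor.Hom.diff_app (q : ℕ) (Z : Set X) (c : A.cochains q Z) :
    B.diff q Z (φ.app q Z c) = φ.app (q + 1) Z (A.diff q Z c) :=
  congrArg (fun f => f.hom c) ((φ.natTrans.app (op Z)).comm q (q + 1))

lemma CochainFunctor.Hom.res_app (q : ℕ) {Y Z : Set X} (h : Y ⊆ Z) (c : A.cochains q Z) :
    B.res q h (φ.app q Z c) = φ.app q Y (A.res q h c) :=
  (congrArg (fun f => (f.f q).hom c) (φ.natTrans.naturality (homOfLE h).op)).symm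

/-- The map of double complexes induced by a natural transformation. -/
def nerveMapAux (p q : ℕ) : nerveCochains U A p q →ₗ[R] nerveCochains U B p q :=
  LinearMap.pi fun σ => φ.app q (inter U σ.1) ∘ₗ LinearMap.proj σ

lemma nerveDelta_nerveMapAux (p q : ℕ) (c : nerveCochains U A p q) :
    nerveDelta U B p q (nerveMapAux U φ p q c) =
      nerveMapAux U φ (p + 1) q (nerveDelta U A p q c) := by
  funext σ
  change _ = φ.app q (inter U σ.1) (nerveDelta U A p q c σ)
  rw [nerveDelta_apply, nerveDelta_apply, map_sum]
  refine Finset.sum_congr rfl fun x _ => ?_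
  rw [map_zsmul]
  exact congrArg _ (φ.res_app q _ _)

/-- The map `T^•(N, A) → T^•(N, B)` induced by a natural transformation. -/
def nerveMap : nerveTotal U A ⟶ nerveTotal U B :=
  DoubleComplex.totalMap (K := nerveDoubleComplex U A) (L := nerveDoubleComplex U B)
    (nerveMapAux U φ) (fun _ q c => funext fun σ => φ.diff_app q _ (c σ))
    (nerveDelta_nerveMapAux U φ)

/-- Here it matters that `φ` is the identity on the augmentation term. -/
lemma lambda_nerveMap : lambda U A ≫ nerveMap U φ = lambda U B := by
  refine HomologicalComplex.hom_ext _ _ fun n => ModuleCat.hom_ext (LinearMap.ext fun c => ?_)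
  refine (DoubleComplex.totalMapAux_incl (K := nerveDoubleComplex U A)
    (L := nerveDoubleComplex U B) (nerveMapAux U φ) (add_zero n) _).trans ?_
  exact congrArg ((nerveDoubleComplex U B).incl n 0 rfl) (funext fun σ => φ.map_aug _ _)

lemma tau_nerveMap :
    tau U A ≫ nerveMap U φ = φ.natTrans.app (op Set.univ) ≫ tau U B := by
  refine HomologicalComplex.hom_ext _ _ fun n => ModuleCat.hom_ext (LinearMap.ext fun c => ?_)
  refine (DoubleComplex.totalMapAux_incl (K := nerveDoubleComplex U A)
    (L := nerveDoubleComplex U B) (nerveMapAux U φ) (zero_add n) _).trans ?_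
  exact congrArg ((nerveDoubleComplex U B).incl 0 n (zero_add n))
    (funext fun σ => (φ.res_app n _ c).symm)

end

/-- The edge argument in the nerve direction: coning gives exactness, gluing gives surjectivity,
subdivision gives acyclicity of the kernel. -/
theorem isIso_tauC [TopologicalSpace X] (hU : ⋃ i, interior (U i) = Set.univ) (n : ℕ) :
    IsIso (tauC U R n) :=
  DoubleComplex.isIso_homologyMap_edge (K := nerveDoubleComplex U (singularCochains X R))
    (fun _ _ _ hc => nerveDelta_exact_succ hc) (tau U (singularCochains X R))
    (ε := fun n => restriction U (singularCochains X R) n) (fun _ => rfl)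
    (fun _ _ hc => exists_restriction_eq hc)
    (fun _ hb hd => restriction_zero_injective hU hb hd)
    (fun _ _ hb hd => exists_restriction_eq_zero_diff_eq hU hb hd) n

end Covering

end Leray

end

theorem mainTheorem2 {X : Type u} [TopologicalSpace X] {R : Type v} [Ring R]
    {V : Type u} [LinearOrder V] (U : V → Set X)
    (hU : ⋃ i, interior (U i) = Set.univ)
    (A : Leray.CochainFunctor.{u, v, max u v} X R)
    (φ : Leray.CochainFunctor.Hom A (Leray.singularCochains X R))
    (hA : Leray.IsAcyclic U A) :
    ∃ hτ : ∀ n : ℕ, IsIso (Leray.tauC U R n),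
      ∀ n : ℕ, ∃ ψ : A.cohomology n Set.univ ⟶ Leray.simplicialCohomology R (Leray.nerve U) n,
        ψ ≫ Leray.lerayMap U R n (hτ n) = Leray.comparison φ n := by
  refine ⟨Leray.isIso_tauC U hU, fun n => ?_⟩
  have hτ := Leray.isIso_tauC U (R := R) hU n
  have hl := Leray.isIso_homologyMap_lambda hA n
  refine ⟨HomologicalComplex.homologyMap (Leray.tau U A) n ≫
    inv (HomologicalComplex.homologyMap (Leray.lambda U A) n), ?_⟩
  -- After multiplying by `τ_C`, writing `λ_C` as `λ_A` followed by `T(φ)` cancels the inverse, and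
  -- the square for `τ` remains.
  rw [Leray.lerayMap, ← Category.assoc, IsIso.comp_inv_eq, Category.assoc, Leray.lambdaC,
    ← Leray.lambda_nerveMap U φ, HomologicalComplex.homologyMap_comp, IsIso.inv_hom_id_assoc,
    ← HomologicalComplex.homologyMap_comp, Leray.tau_nerveMap,
    HomologicalComplex.homologyMap_comp]
  rfl
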